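/- Let $\mathbb I=\{0<1\}$ and let $\square$ be the category whose objects are the posets $\mathbb I^n$, $n\ge 0$, and whose morphisms are the maps that are composites of the face maps $\delta_i^{k,\tau}:\mathbb I^{k-1}\to\mathbb I^k$, $\delta_i^{k,\tau}(x_1,\dots,x_{k-1})=(x_1,\dots,x_{i-1},\tau,x_i,\dots,x_{k-1})$, and the degeneracy maps $\epsilon_i^k:\mathbb I^k\to\mathbb I^{k-1}$, $\epsilon_i^k(x_1,\dots,x_k)=(x_1,\dots,x_{i-1},x_{i+1},\dots,x_k)$, for $k\ge1$, $1\le i\le k$, $\tau\in\{0,1\}$. A cubical set is a functor $X:\square^{op}\to\mathrm{Set}$; write $X_n=X(\mathbb I^n)$. Let $\square/X$ be the comma category of the Yoneda embedding over $X$: its objects are the morphisms $\tilde x:\square(-,\mathbb I^n)\to X$, which correspond to the elements $x\in X_n$, $n\ge0$, and its morphisms are commutative triangles over $X$. A contravariant system on $X$ is a functor $F:(\square/X)^{op}\to\mathrm{Ab}$. For such an $F$ let $C_n(X,F)=\bigoplus_{x\in X_n}F(\tilde x)$. This is a cubical Abelian group: a morphism $\alpha:\mathbb I^m\to\mathbb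 I^n$ of $\square$ acts as the homomorphism $C_n(X,F)\to C_m(X,F)$ that sends the summand of $x$ to the summand of $X(\alpha)(x)$ by $F(\alpha:\widetilde{X(\alpha)(x)}\to\tilde x)$. Let $D_n(X,F)\subseteq C_n(X,F)$ be the sum of the images of the operators of $\epsilon_1^n,\dots,\epsilon_n^n$ (so $D_0(X,F)=0$). The normalized complex $C^N_*(X,F)$ consists of the groups $C^N_n(X,F)=C_n(X,F)/D_n(X,F)$ for $n\ge0$, and $0$ for $n<0$, with the differentials induced by $d_n=\sum_{i=1}^n(-1)^i(d_i^{n,0}-d_i^{n,1})$, where $d_i^{n,\tau}$ is the operator of $\delta_i^{n,\tau}$. Put $H_n(X,F)=H_n(C^N_*(X,F))$. **Theorem.** For every cubical set $X$, every contravariant system $F:(\square/X)^{op}\to\mathrm{Ab}$ and every $n\ge0$ there is an isomorphism $$H_n(X,F)\;\cong\;\varinjlim\nolimits_n^{(\square/X)^{op}}F,$$ where $\varinjlim_n^{(\square/X)^{op}}:\mathrm{Ab}^{(\square/X)^{op}}\to\mathrm{Ab}$ is the $n$-th left derived functor of the colimit functor. -/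

import Mathlib

open CategoryTheory CategoryTheory.Limits Opposite

universe u

namespace CubicalHomology

/-! ### The category of cubes -/

/-- The `n`-dimensional cube `{0, 1}ⁿ` (with `0 = false < true = 1`), ordered componentwise. -/
abbrev Pt (n : ℕ) : Type := Fin n → Bool

/-- The face map `{0,1}ᵏ → {0,1}ᵏ⁺¹` inserting the coordinate `τ` at place `i` (counted from 0). -/
def faceMap {k : ℕ} (i : Fin (k + 1)) (τ : Bool) : Pt k →o Pt (k + 1) where
  toFun x := i.insertNth (α := fun _ => Bool) τ x
  monotone' x y h := by
    rw [Fin.insertNth_le_iff]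
    refine ⟨by simp, fun j => ?_⟩
    simpa using h j

/-- The degeneracy map `{0,1}ᵏ⁺¹ → {0,1}ᵏ` deleting the coordinate at place `i`
(counted from 0). -/
def degenMap {k : ℕ} (i : Fin (k + 1)) : Pt (k + 1) →o Pt k where
  toFun x := i.removeNth x
  monotone' _ _ h j := h (i.succAbove j)

/-- The maps between cubes that are composites of face maps and degeneracy maps
(identities being the empty composites). -/
inductive IsCubeMap : {p q : ℕ} → (Pt p →o Pt q) → Prop
  | id (n : ℕ) : IsCubeMap (OrderHom.id : Pt n →o Pt n)
  | face {k : ℕ} (i : Fin (k + 1)) (τ : Bool) : IsCubeMap (faceMap i τ)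
  | degen {k : ℕ} (i : Fin (k + 1)) : IsCubeMap (degenMap i)
  | comp {p q r : ℕ} {f : Pt p →o Pt q} {g : Pt q →o Pt r} :
      IsCubeMap f → IsCubeMap g → IsCubeMap (g.comp f)

/-- The objects of the category of cubes, one for each dimension. -/
structure CubeCat : Type where
  /-- The dimension of the cube. -/
  dim : ℕ

/-- The category of cubes: its morphisms are the nondecreasing maps generated by the face
and degeneracy maps. -/
instance : SmallCategory CubeCat where
  Hom p q := { f : Pt p.dim →o Pt q.dim // IsCubeMap f }
  id p := ⟨OrderHom.id, IsCubeMap.id p.dim⟩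
  comp f g := ⟨g.1.comp f.1, IsCubeMap.comp f.2 g.2⟩

/-- The cube of dimension `n` as an object of the category of cubes. -/
abbrev cube (n : ℕ) : CubeCat := ⟨n⟩

/-- The face morphisms of the category of cubes. -/
def face {k : ℕ} (i : Fin (k + 1)) (τ : Bool) : cube k ⟶ cube (k + 1) :=
  ⟨faceMap i τ, IsCubeMap.face i τ⟩

/-- The degeneracy morphisms of the category of cubes. -/
def degen {k : ℕ} (i : Fin (k + 1)) : cube (k + 1) ⟶ cube k :=
  ⟨degenMap i, IsCubeMap.degen i⟩

theorem face_comp_face {k : ℕ} (i : Fin (k + 2)) (j : Fin (k + 1)) (a b : Bool) :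
    face j b ≫ face i a = face (j.predAbove i) a ≫ face (i.succAbove j) b := by
  apply Subtype.ext
  apply OrderHom.ext
  funext x
  change i.insertNth (α := fun _ => Bool) a (j.insertNth (α := fun _ => Bool) b x) =
    (i.succAbove j).insertNth (α := fun _ => Bool) b
      ((j.predAbove i).insertNth (α := fun _ => Bool) a x)
  rw [Fin.insertNth_eq_iff]
  refine ⟨?_, ?_⟩
  · have h := Fin.insertNth_apply_succAbove (α := fun _ => Bool) (i.succAbove j) b
      ((j.predAbove i).insertNth (α := fun _ => Bool) a x) (j.predAbove i)
    rw [Fin.succAbove_succAbove_predAbove, Fin.insertNth_apply_same] at h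
    exact h.symm
  · rw [Fin.insertNth_eq_iff]
    refine ⟨?_, ?_⟩
    · simp only [Fin.removeNth]
      rw [Fin.insertNth_apply_same]
    · funext m
      simp only [Fin.removeNth]
      rw [← Fin.succAbove_succAbove_succAbove_predAbove, Fin.insertNth_apply_succAbove,
        Fin.insertNth_apply_succAbove]

theorem face_comp_degen_self {k : ℕ} (i : Fin (k + 1)) (τ : Bool) :
    face i τ ≫ degen i = 𝟙 (cube k) := by
  apply Subtype.ext
  apply OrderHom.ext
  funext x
  exact Fin.removeNth_insertNth (α := fun _ => Bool) i τ x

theorem face_comp_degen {k : ℕ} (i : Fin (k + 2)) (j : Fin (k + 1)) (τ : Bool) :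
    face i τ ≫ degen (i.succAbove j) = degen j ≫ face (j.predAbove i) τ := by
  apply Subtype.ext
  apply OrderHom.ext
  funext x
  change (i.succAbove j).removeNth (i.insertNth (α := fun _ => Bool) τ x) =
    (j.predAbove i).insertNth (α := fun _ => Bool) τ (j.removeNth x)
  rw [Fin.eq_insertNth_iff]
  refine ⟨?_, ?_⟩
  · simp only [Fin.removeNth]
    rw [Fin.succAbove_succAbove_predAbove, Fin.insertNth_apply_same]
  · funext m
    simp only [Fin.removeNth]
    rw [Fin.succAbove_succAbove_succAbove_predAbove, Fin.insertNth_apply_succAbove]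

theorem predAbove_add_succAbove {k : ℕ} (i : Fin (k + 2)) (j : Fin (k + 1)) :
    ((j.predAbove i : ℕ) + (i.succAbove j : ℕ)) + 1 = (j : ℕ) + i ∨
      ((j.predAbove i : ℕ) + (i.succAbove j : ℕ)) = (j : ℕ) + i + 1 := by
  rcases Fin.lt_or_le j.castSucc i with h | h
  · left
    rw [Fin.predAbove_of_castSucc_lt _ _ h, Fin.succAbove_of_castSucc_lt _ _ h]
    simp only [Fin.val_pred, Fin.val_castSucc]
    have : (j : ℕ) < i := h
    omega
  · right
    rw [Fin.predAbove_of_le_castSucc _ _ h, Fin.succAbove_of_le_castSucc _ _ h]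
    simp only [Fin.coe_castPred, Fin.val_succ]
    omega

/-! ### The normalized complex of a cubical Abelian group -/

section Normalized

variable (A : CubeCatᵒᵖ ⥤ AddCommGrpCat.{u})

/-- The difference `A(δᵢ⁰) - A(δᵢ¹)` of two opposite face operators. -/
def faceDiff {k : ℕ} (i : Fin (k + 1)) : A.obj (op (cube (k + 1))) ⟶ A.obj (op (cube k)) :=
  A.map (face i false).op - A.map (face i true).op

/-- The differential `∑ᵢ (-1)ⁱ (A(δᵢ⁰) - A(δᵢ¹))`, the index `i` running over `1, …, k + 1`. -/
def diff (k : ℕ) : A.obj (op (cube (k + 1))) ⟶ A.obj (op (cube k)) :=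
  ∑ i : Fin (k + 1), (-1 : ℤ) ^ ((i : ℕ) + 1) • faceDiff A i

/-- The subgroup of degenerate chains: the sum of the images of the degeneracy operators. -/
def degenerate : (k : ℕ) → AddSubgroup (A.obj (op (cube k)))
  | 0 => ⊥
  | k + 1 => ⨆ i : Fin (k + 1), (A.map (degen i).op).hom.range

theorem faceDiff_comp_faceDiff {k : ℕ} (i : Fin (k + 2)) (j : Fin (k + 1)) :
    faceDiff A i ≫ faceDiff A j = faceDiff A (i.succAbove j) ≫ faceDiff A (j.predAbove i) := by
  simp only [faceDiff, Preadditive.sub_comp, Preadditive.comp_sub, ← A.map_comp, ← op_comp]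
  simp only [face_comp_face i j]
  abel

theorem diff_comp_diff (k : ℕ) : diff A (k + 1) ≫ diff A k = 0 := by
  have h : diff A (k + 1) ≫ diff A k = ∑ p : Fin (k + 2) × Fin (k + 1),
      ((-1 : ℤ) ^ ((p.2 : ℕ) + p.1)) • (faceDiff A p.1 ≫ faceDiff A p.2) := by
    rw [Fintype.sum_prod_type]
    simp only [diff, Preadditive.comp_sum, Preadditive.sum_comp]
    rw [Finset.sum_comm]
    refine Finset.sum_congr rfl fun i _ => Finset.sum_congr rfl fun j _ => ?_
    rw [Preadditive.zsmul_comp, Preadditive.comp_zsmul, smul_smul]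
    congr 1
    ring
  rw [h]
  refine Finset.sum_involution (fun p _ => (p.1.succAbove p.2, p.2.predAbove p.1)) ?_ ?_ ?_ ?_
  · rintro ⟨i, j⟩ _
    dsimp only
    rw [← faceDiff_comp_faceDiff, ← add_smul]
    have h2 : (-1 : ℤ) ^ ((j : ℕ) + i) +
        (-1) ^ ((j.predAbove i : ℕ) + (i.succAbove j : ℕ)) = 0 := by
      rcases predAbove_add_succAbove i j with h | h
      · rw [← h, pow_succ]; ring
      · rw [h, pow_succ]; ring
    rw [h2, zero_smul]
  · rintro ⟨i, j⟩ _ _ h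
    exact Fin.succAbove_ne i j (congrArg Prod.fst h)
  · intros
    exact Finset.mem_univ _
  · rintro ⟨i, j⟩ _
    exact Prod.ext (Fin.succAbove_succAbove_predAbove i j)
      (Fin.predAbove_predAbove_succAbove i j)

theorem faceDiff_degen_self {k : ℕ} (i : Fin (k + 1)) :
    A.map (degen i).op ≫ faceDiff A i = 0 := by
  simp only [faceDiff, Preadditive.comp_sub, ← A.map_comp, ← op_comp, face_comp_degen_self]
  exact sub_self _

theorem faceDiff_degen {k : ℕ} (i : Fin (k + 2)) (j : Fin (k + 1)) :
    A.map (degen (i.succAbove j)).op ≫ faceDiff A i =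
      faceDiff A (j.predAbove i) ≫ A.map (degen j).op := by
  simp only [faceDiff, Preadditive.comp_sub, Preadditive.sub_comp, ← A.map_comp, ← op_comp,
    face_comp_degen]

theorem faceDiff_degen_mem {k : ℕ} (i j : Fin (k + 1)) (y : A.obj (op (cube k))) :
    (faceDiff A i).hom ((A.map (degen j).op).hom y) ∈ degenerate A k := by
  rcases Fin.eq_self_or_eq_succAbove i j with rfl | ⟨j, rfl⟩
  · have h := ConcreteCategory.congr_hom (faceDiff_degen_self A j) y
    have h' : (faceDiff A j).hom ((A.map (degen j).op).hom y) = 0 := h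
    rw [h']
    exact zero_mem _
  · cases k with
    | zero => exact j.elim0
    | succ k =>
      have h := ConcreteCategory.congr_hom (faceDiff_degen A i j) y
      have h' : (faceDiff A i).hom ((A.map (degen (i.succAbove j)).op).hom y) =
        (A.map (degen j).op).hom ((faceDiff A (j.predAbove i)).hom y) := h
      rw [h']
      exact AddSubgroup.mem_iSup_of_mem j ⟨_, rfl⟩

theorem degenerate_le_comap (k : ℕ) :
    degenerate A (k + 1) ≤ (degenerate A k).comap (diff A k).hom := by
  refine iSup_le fun j => ?_
  rintro _ ⟨y, rfl⟩
  have h : (diff A k).hom = ∑ i : Fin (k + 1), (-1 : ℤ) ^ ((i : ℕ) + 1) • (faceDiff A i).hom := by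
    have := map_sum (AddCommGrpCat.homAddEquiv (M := A.obj (op (cube (k + 1))))
      (N := A.obj (op (cube k)))) (fun i : Fin (k + 1) =>
        (-1 : ℤ) ^ ((i : ℕ) + 1) • faceDiff A i) Finset.univ
    exact this
  rw [AddSubgroup.mem_comap, h, AddMonoidHom.finsetSum_apply]
  exact sum_mem fun i _ => zsmul_mem (faceDiff_degen_mem A i j y) _

/-- The differential of the normalized complex, induced on quotient groups. -/
def normalizedDiff (k : ℕ) :
    AddCommGrpCat.of (A.obj (op (cube (k + 1))) ⧸ degenerate A (k + 1)) ⟶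
      AddCommGrpCat.of (A.obj (op (cube k)) ⧸ degenerate A k) :=
  AddCommGrpCat.ofHom (QuotientAddGroup.map _ _ (diff A k).hom (degenerate_le_comap A k))

theorem normalizedDiff_comp (k : ℕ) : normalizedDiff A (k + 1) ≫ normalizedDiff A k = 0 := by
  apply AddCommGrpCat.hom_ext
  apply QuotientAddGroup.addMonoidHom_ext
  ext x
  have h := ConcreteCategory.congr_hom (diff_comp_diff A k) x
  exact congrArg (QuotientAddGroup.mk (s := degenerate A k)) h

/-- The normalized complex of a cubical Abelian group: the chains modulo the degenerate chains. -/
noncomputable def normalizedComplex : ChainComplex AddCommGrpCat.{u} ℕ :=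
  ChainComplex.of (fun k => AddCommGrpCat.of (A.obj (op (cube k)) ⧸ degenerate A k))
    (normalizedDiff A) (normalizedDiff_comp A)

end Normalized

/-! ### Contravariant systems on a cubical set -/

section Systems

variable (X : CubeCatᵒᵖ ⥤ Type u)

/-- The category `□/X` of singular cubes of `X`: the objects are the morphisms of cubical sets from
a standard cube to `X`, the morphisms are the commutative triangles over `X`. -/
abbrev SingularCubes : Type u :=
  CostructuredArrow (uliftYoneda.{u} : CubeCat ⥤ CubeCatᵒᵖ ⥤ Type u) X

variable {X}

/-- The singular cube corresponding to an element `x` of `X(c)` by the Yoneda lemma. -/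
def tilde {c : CubeCatᵒᵖ} (x : X.obj c) : SingularCubes X :=
  CostructuredArrow.mk (Y := c.unop) (uliftYonedaEquiv.{u}.symm x)

/-- The morphism of `□/X` over `α` from the singular cube of `X(α)(x)` to that of `x`. -/
def tildeMap {c d : CubeCatᵒᵖ} (α : c ⟶ d) (x : X.obj c) : tilde (X.map α x) ⟶ tilde x :=
  CostructuredArrow.homMk α.unop (uliftYonedaEquiv_symm_map α x).symm

variable (F : (SingularCubes X)ᵒᵖ ⥤ AddCommGrpCat.{u})

theorem map_comp_ι_eq {c : CubeCatᵒᵖ} {x y : X.obj c} (h : y = x) {z : SingularCubes X}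
    (f : tilde y ⟶ z) (g : tilde x ⟶ z) (hfg : f.left = g.left) :
    F.map f.op ≫ Sigma.ι (fun y : X.obj c => F.obj (op (tilde y))) y =
      F.map g.op ≫ Sigma.ι (fun y : X.obj c => F.obj (op (tilde y))) x := by
  subst h
  have : f = g := CostructuredArrow.hom_ext _ _ hfg
  rw [this]

/-- The cubical Abelian group with values `⨁_{x ∈ X(c)} F(x)`; the operator of `α` sends the
summand of `x` to the summand of `X(α)(x)` by `F(α)`. -/
noncomputable def chains : CubeCatᵒᵖ ⥤ AddCommGrpCat.{u} where
  obj c := ∐ fun x : X.obj c => F.obj (op (tilde x))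
  map {c d} α := Sigma.desc fun x =>
    F.map (tildeMap α x).op ≫ Sigma.ι (fun y : X.obj d => F.obj (op (tilde y))) (X.map α x)
  map_id c := by
    refine Sigma.hom_ext _ _ fun x => ?_
    rw [Sigma.ι_desc, Category.comp_id]
    refine (map_comp_ι_eq F (by simp) (tildeMap (𝟙 c) x) (𝟙 _) rfl).trans ?_
    rw [op_id, F.map_id, Category.id_comp]
  map_comp {a b c} α β := by
    refine Sigma.hom_ext _ _ fun x => ?_
    rw [Sigma.ι_desc, Sigma.ι_desc_assoc, Category.assoc, Sigma.ι_desc, ← Category.assoc,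
      ← F.map_comp, ← op_comp]
    exact map_comp_ι_eq F (by simp) (tildeMap (α ≫ β) x) (tildeMap β (X.map α x) ≫ tildeMap α x)
      rfl

end Systems

/-! ### Derived functors of the colimit -/

instance : EnoughProjectives AddCommGrpCat.{u} :=
  ((forget₂ (ModuleCat.{u} ℤ) AddCommGrpCat.{u}).asEquivalence.enoughProjectives_iff).1
    inferInstance

/-- Diagrams of Abelian groups on a small category have projective presentations, so that left
derived functors are defined on them. -/
instance {J : Type u} [Category.{0} J] : EnoughProjectives (J ⥤ AddCommGrpCat.{u}) where
  presentation F := by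
    let P : J ⥤ AddCommGrpCat.{u} :=
      ∐ fun j : J => (evaluationLeftAdjoint AddCommGrpCat.{u} j).obj (Projective.over (F.obj j))
    have hP : Projective P := by
      have (j : J) := (evaluationAdjunctionRight AddCommGrpCat.{u} j).map_projective
        (Projective.over (F.obj j)) inferInstance
      infer_instance
    let t (j : J) := ((evaluationAdjunctionRight AddCommGrpCat.{u} j).homEquiv _ F).symm
      (Projective.π (F.obj j))
    let f : P ⟶ F := Sigma.desc t
    have hf : Epi f := by
      have (j : J) : Epi (f.app j) := by
        have e : ((evaluationAdjunctionRight AddCommGrpCat.{u} j).homEquiv _ F) (t j) =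
          Projective.π (F.obj j) := Equiv.apply_symm_apply _ _
        rw [Adjunction.homEquiv_unit] at e
        have e2 : t j = Sigma.ι _ j ≫ f := (Sigma.ι_desc _ _).symm
        rw [e2, Functor.map_comp, ← Category.assoc] at e
        exact epi_of_epi_fac e
      exact NatTrans.epi_of_epi_app f
    exact ⟨{ p := P, projective := hP, f := f, epi := hf }⟩

end CubicalHomology

/-! Left derived functors are recognised by dimension shifting (`homology_iso_leftDerived`). Suppose
that a functor `N` to chain complexes takes short exact sequences to short exact sequences, has no
homology in positive degrees on projectives, and has `H₀ ∘ N ≅ G` with `G` right exact. Then the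
long exact sequences along a projective resolution give `Hₙ ∘ N ≅ LₙG`. Here `N` sends a system `F`
to the normalized complex of its chains, and `G` is the colimit.

Exactness. In each dimension the chains are a coproduct of values of `F`, and coproducts of Abelian
groups are exact. Normalization is exact because the degenerate chains split off naturally: the
product of the operators `1 - uᵢ`, where `uᵢ` sets the `i`-th coordinate to zero, kills them and is
the identity modulo them.

Degree zero. The vertices of a cube are joined by edges, so identifying the two ends of every
1-chain already computes the colimit of a cubical group. The chains are the left Kan extension of
`F` along the dimension functor (`chainsAdjunction`), so their colimit is that of `F`.

Acyclicity. The right adjoint of the chain functor is a restriction and preserves epimorphisms, so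
chains of projectives are projective. A projective cubical group is a retract of a coproduct of free
ones, which reduces the claim to the standard cubes with coefficients. These are contracted one
coordinate at a time by an explicit homotopy. It is checked on the generators by means of a
trichotomy for morphisms of cubes (`last_coordinate_cases`), which rests on the fact that variables
are neither permuted nor repeated. -/

namespace CubicalHomology

/-! ### Dimension shifting and left derived functors -/

section Derived

universe v₁ v₂ u₁ u₂

variable {C : Type u₁} [Category.{v₁} C] [Abelian C] {D : Type u₂} [Category.{v₂} D] [Abelian D]

/-- The short complex `Kₙ₊₁ ⟶ Rₙ ⟶ Kₙ` of the opcycles of a chain complex `R`. -/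
noncomputable abbrev opcyclesSequence (R : ChainComplex C ℕ) (n : ℕ) : ShortComplex C :=
  ShortComplex.mk (R.fromOpcycles (n + 1) n) (R.pOpcycles n) (by
    rw [← cancel_epi (R.pOpcycles (n + 1))]
    simp)

/-- The kernel of `Kₙ₊₁ ⟶ Rₙ` is `Hₙ₊₁(R)`, which vanishes. In the middle, `Kₙ` is the cokernel of
`Rₙ₊₁ ⟶ Rₙ`, and replacing `Rₙ₊₁` by its quotient `Kₙ₊₁` does not change the image. -/
theorem opcyclesSequence_shortExact (R : ChainComplex C ℕ) (n : ℕ) (h : R.ExactAt (n + 1)) :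
    (opcyclesSequence R n).ShortExact where
  exact := by
    have h := ShortComplex.exact_of_g_is_cokernel (ShortComplex.mk (R.d (n + 1) n) (R.pOpcycles n)
      (by simp)) (R.opcyclesIsCokernel (n + 1) n (by simp))
    let φ : ShortComplex.mk (R.d (n + 1) n) (R.pOpcycles n) (by simp) ⟶ opcyclesSequence R n :=
      { τ₁ := R.pOpcycles (n + 1), τ₂ := 𝟙 _, τ₃ := 𝟙 _ }
    have : Epi φ.τ₁ := inferInstanceAs (Epi (R.pOpcycles (n + 1)))
    have : IsIso φ.τ₂ := inferInstanceAs (IsIso (𝟙 _))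
    have : Mono φ.τ₃ := inferInstanceAs (Mono (𝟙 _))
    exact (ShortComplex.exact_iff_of_epi_of_isIso_of_mono φ).1 h
  mono_f := Preadditive.mono_of_isZero_kernel' _ (R.homologyIsKernel (n + 1) n (by simp))
    h.isZero_homology
  epi_g := inferInstanceAs (Epi (R.pOpcycles n))

/-- A right exact functor commutes with the formation of opcycles. -/
noncomputable def mapOpcyclesIso (G : C ⥤ D) [G.Additive] [PreservesFiniteColimits G]
    (R : ChainComplex C ℕ) (n : ℕ) :
    ((G.mapHomologicalComplex _).obj R).opcycles (n + 1) ≅ G.obj (R.opcycles (n + 1)) :=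
  (((G.mapHomologicalComplex _).obj R).opcyclesIsCokernel (n + 2) (n + 1)
    (by simp)).coconePointUniqueUpToIso
    (CokernelCofork.mapIsColimit _ (R.opcyclesIsCokernel (n + 2) (n + 1) (by simp)) G)

theorem p_mapOpcyclesIso_hom (G : C ⥤ D) [G.Additive] [PreservesFiniteColimits G]
    (R : ChainComplex C ℕ) (n : ℕ) :
    ((G.mapHomologicalComplex _).obj R).pOpcycles (n + 1) ≫ (mapOpcyclesIso G R n).hom =
      G.map (R.pOpcycles (n + 1)) :=
  (((G.mapHomologicalComplex _).obj R).opcyclesIsCokernel (n + 2) (n + 1)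
    (by simp)).comp_coconePointUniqueUpToIso_hom
    (CokernelCofork.mapIsColimit _ (R.opcyclesIsCokernel (n + 2) (n + 1) (by simp)) G)
    WalkingParallelPair.one

/-- The homology of the image of a complex under a right exact functor, in terms of the images of
the opcycles. -/
noncomputable def mapHomologySuccIso (G : C ⥤ D) [G.Additive] [PreservesFiniteColimits G]
    (R : ChainComplex C ℕ) (n : ℕ) :
    ((G.mapHomologicalComplex _).obj R).homology (n + 1) ≅
      kernel (G.map (R.fromOpcycles (n + 1) n)) :=
  (((G.mapHomologicalComplex _).obj R).homologyIsKernel (n + 1) n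
    (by simp)).conePointUniqueUpToIso (limit.isLimit _) ≪≫
    kernel.mapIso (((G.mapHomologicalComplex _).obj R).fromOpcycles (n + 1) n)
      (G.map (R.fromOpcycles (n + 1) n)) (mapOpcyclesIso G R n) (Iso.refl _) (by
        rw [← cancel_epi (((G.mapHomologicalComplex _).obj R).pOpcycles (n + 1))]
        have := p_mapOpcyclesIso_hom G R n
        rw [reassoc_of% this]
        refine (congrArg (_ ≫ ·) (Category.comp_id _)).trans ?_
        exact (HomologicalComplex.p_fromOpcycles _ _ _).trans
          ((congrArg G.map (R.p_fromOpcycles (n + 1) n)).symm.trans (G.map_comp _ _)))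

variable (N : C ⥤ ChainComplex D ℕ) [N.PreservesZeroMorphisms]

/-- Dimension shifting in degree one. -/
theorem homology_one_iso_kernel {S : ShortComplex C} (hS : (S.map N).ShortExact)
    (hP : IsZero ((N.obj S.X₂).homology 1)) {G : C ⥤ D}
    (α : N ⋙ HomologicalComplex.homologyFunctor D _ 0 ≅ G) :
    Nonempty ((N.obj S.X₃).homology 1 ≅ kernel (G.map S.f)) := by
  -- The connecting map `H₁(N X₃) ⟶ H₀(N X₁)` is injective because `H₁(N X₂) = 0`, and its image is
  -- the kernel of `H₀(N X₁) ⟶ H₀(N X₂)`.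
  have : Mono (hS.δ 1 0 (by simp)) := hS.mono_δ 1 0 _ hP
  exact ⟨(hS.homology_exact₁ 1 0 _).fIsKernel.conePointUniqueUpToIso (limit.isLimit _) ≪≫
    kernel.mapIso _ _ (α.app S.X₁) (α.app S.X₂) (α.hom.naturality S.f)⟩

/-- An exact functor to chain complexes whose homology vanishes in positive degrees on projective
objects computes the left derived functors of its homology in degree zero. -/
theorem homology_iso_leftDerived [EnoughProjectives C]
    (hN : ∀ S : ShortComplex C, S.ShortExact → (S.map N).ShortExact)
    (hP : ∀ (P : C) [Projective P] (n : ℕ), IsZero ((N.obj P).homology (n + 1)))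
    (G : C ⥤ D) [G.Additive] [PreservesFiniteColimits G]
    (α : N ⋙ HomologicalComplex.homologyFunctor D _ 0 ≅ G) (F : C) (n : ℕ) :
    Nonempty ((N.obj F).homology n ≅ (G.leftDerived n).obj F) := by
  cases n with
  | zero => exact ⟨α.app F ≪≫ (G.leftDerivedZeroIsoSelf.app F).symm⟩
  | succ n =>
    let R : ProjectiveResolution F := ProjectiveResolution.of F
    have hS (i : ℕ) := opcyclesSequence_shortExact R.complex i (R.complex_exactAt_succ i)
    -- With `Kᵢ` the opcycles of the resolution, each sequence `Kᵢ₊₁ ⟶ Rᵢ ⟶ Kᵢ` trades one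
    -- homological degree for one syzygy. Starting from `K₀ ≅ F` this leads to `H₁(N Kₙ)`, the
    -- kernel of `G Kₙ₊₁ ⟶ G Rₙ`, which is also `Hₙ₊₁(G R)`.
    have shift (k i : ℕ) : Nonempty ((N.obj (R.complex.opcycles i)).homology (k + 1) ≅
        (N.obj (R.complex.opcycles (i + k))).homology 1) := by
      induction k generalizing i with
      | zero => exact ⟨Iso.refl _⟩
      | succ k ih =>
        obtain ⟨e⟩ := ih (i + 1)
        rw [show i + 1 + k = i + (k + 1) by omega] at e
        exact ⟨(hN _ (hS i)).δIso (k + 1 + 1) (k + 1) (by simp)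
          (hP (R.complex.X i) _) (hP (R.complex.X i) _) ≪≫ e⟩
    obtain ⟨e₁⟩ := shift n 0
    rw [Nat.zero_add] at e₁
    obtain ⟨e₂⟩ := homology_one_iso_kernel N (hN _ (hS n)) (hP (R.complex.X n) _) α
    let e₀ : R.complex.opcycles 0 ≅ F :=
      (R.complex.opcyclesIsCokernel 1 0 (by simp)).coconePointUniqueUpToIso
        R.isColimitCokernelCofork
    exact ⟨(HomologicalComplex.homologyFunctor D _ (n + 1)).mapIso (N.mapIso e₀.symm) ≪≫ e₁ ≪≫
      e₂ ≪≫ (mapHomologySuccIso G R.complex n).symm ≪≫ (R.isoLeftDerivedObj G (n + 1)).symm⟩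

end Derived

/-! ### Chains of a contravariant system as a left adjoint -/

section ChainsAdjunction

variable {X : CubeCatᵒᵖ ⥤ Type u}

section

variable (F : (SingularCubes X)ᵒᵖ ⥤ AddCommGrpCat.{u}) {c d : CubeCatᵒᵖ}

/-- The inclusion of the summand of `x` into the chains. -/
noncomputable def chainι (x : X.obj c) : F.obj (op (tilde x)) ⟶ (chains F).obj c :=
  Sigma.ι (fun y : X.obj c => F.obj (op (tilde y))) x

variable {F} in
theorem chains_hom_ext {M : AddCommGrpCat.{u}} {f g : (chains F).obj c ⟶ M}
    (h : ∀ x : X.obj c, chainι F x ≫ f = chainι F x ≫ g) : f = g :=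
  Sigma.hom_ext _ _ h

variable {F} in
/-- Homomorphisms out of the chains are determined by their values on the summands. -/
noncomputable def chainDesc {M : AddCommGrpCat.{u}} (f : ∀ x : X.obj c, F.obj (op (tilde x)) ⟶ M) :
    (chains F).obj c ⟶ M :=
  Limits.Sigma.desc f

variable {F} in
@[simp]
theorem chainι_desc {M : AddCommGrpCat.{u}} (f : ∀ x : X.obj c, F.obj (op (tilde x)) ⟶ M)
    (x : X.obj c) : chainι F x ≫ chainDesc f = f x :=
  Sigma.ι_desc _ _

variable {F} in
@[simp]
theorem chainι_desc_assoc {M M' : AddCommGrpCat.{u}}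
    (f : ∀ x : X.obj c, F.obj (op (tilde x)) ⟶ M) (x : X.obj c) (g : M ⟶ M') :
    chainι F x ≫ chainDesc f ≫ g = f x ≫ g := by
  rw [← Category.assoc, chainι_desc]

theorem chainι_map (α : c ⟶ d) (x : X.obj c) :
    chainι F x ≫ (chains F).map α = F.map (tildeMap α x).op ≫ chainι F (X.map α x) :=
  Sigma.ι_desc _ _

theorem chainι_map_assoc (α : c ⟶ d) (x : X.obj c) {M : AddCommGrpCat.{u}}
    (g : (chains F).obj d ⟶ M) :
    chainι F x ≫ (chains F).map α ≫ g =
      F.map (tildeMap α x).op ≫ chainι F (X.map α x) ≫ g := by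
  rw [← Category.assoc, chainι_map, Category.assoc]

/-- Summands indexed by propositionally equal elements have different types. They are compared
through maps to a common singular cube, and such maps are determined by the underlying morphism of
cubes. -/
theorem map_comp_chainι_eq {x y : X.obj c} (h : y = x) {z : SingularCubes X}
    (f : tilde y ⟶ z) (g : tilde x ⟶ z) (hfg : f.left = g.left) :
    F.map f.op ≫ chainι F y = F.map g.op ≫ chainι F x :=
  map_comp_ι_eq F h f g hfg

end

variable (X) in
/-- The chains of a contravariant system are functorial in the system. -/
noncomputable def chainsFunctor :
    ((SingularCubes X)ᵒᵖ ⥤ AddCommGrpCat.{u}) ⥤ CubeCatᵒᵖ ⥤ AddCommGrpCat.{u} where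
  obj F := chains F
  map {F G} η :=
    { app := fun c => chainDesc fun x => η.app (op (tilde x)) ≫ chainι G x
      naturality := fun c d α => by
        refine chains_hom_ext fun x => ?_
        simp [chainι_map, chainι_map_assoc] }
  map_id F := by
    ext c : 2
    refine chains_hom_ext fun x => ?_
    simp
  map_comp η θ := by
    ext c : 2
    refine chains_hom_ext fun x => ?_
    simp

@[simp]
theorem chainι_chainsFunctor_map_app {F G : (SingularCubes X)ᵒᵖ ⥤ AddCommGrpCat.{u}} (η : F ⟶ G)
    {c : CubeCatᵒᵖ} (x : X.obj c) :
    chainι F x ≫ ((chainsFunctor X).map η).app c = η.app (op (tilde x)) ≫ chainι G x :=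
  chainι_desc _ _

@[simp]
theorem chainι_chainsFunctor_map_app_assoc {F G : (SingularCubes X)ᵒᵖ ⥤ AddCommGrpCat.{u}}
    (η : F ⟶ G) {c : CubeCatᵒᵖ} (x : X.obj c) {M : AddCommGrpCat.{u}}
    (g : (chains G).obj c ⟶ M) :
    chainι F x ≫ ((chainsFunctor X).map η).app c ≫ g = η.app (op (tilde x)) ≫ chainι G x ≫ g :=
  chainι_desc_assoc _ _ _ |>.trans (Category.assoc _ _ _)

variable (X) in
/-- The dimension of the singular cubes of `X`. -/
abbrev dimFunctor : (SingularCubes X)ᵒᵖ ⥤ CubeCatᵒᵖ :=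
  (CostructuredArrow.proj (uliftYoneda.{u} : CubeCat ⥤ CubeCatᵒᵖ ⥤ Type u) X).op

/-- The element of `X` corresponding to a singular cube. -/
def elementOf (j : SingularCubes X) : X.obj (op j.left) :=
  uliftYonedaEquiv.{u} j.hom

theorem elementOf_tilde {c : CubeCatᵒᵖ} (x : X.obj c) : elementOf (tilde x) = x :=
  uliftYonedaEquiv.apply_symm_apply x

theorem map_elementOf {i j : SingularCubes X} (f : i ⟶ j) :
    X.map f.left.op (elementOf j) = elementOf i := by
  rw [elementOf, elementOf, ← CostructuredArrow.w f]
  exact (uliftYonedaEquiv_naturality _ _)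

/-- The isomorphism between a singular cube and the one of its element, as a morphism. -/
def tildeElementOf (j : SingularCubes X) : tilde (elementOf j) ⟶ j :=
  CostructuredArrow.homMk (𝟙 j.left) (by simp [tilde, elementOf])

variable (X) in
/-- Taking chains is left adjoint to the restriction along the dimension functor. -/
noncomputable def chainsAdjunction :
    chainsFunctor X ⊣ (Functor.whiskeringLeft _ _ AddCommGrpCat.{u}).obj (dimFunctor X) :=
  Adjunction.mkOfHomEquiv
    { homEquiv := fun F B =>
        { toFun := fun φ =>
            { app := fun j => F.map (tildeElementOf j.unop).op ≫ chainι F (elementOf j.unop) ≫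
                NatTrans.app (F := chains F) φ (op j.unop.left)
              naturality := fun i j f => by
                -- Both routes from the singular cube of the restricted element to `i` lie over the
                -- same morphism of cubes.
                have h := map_comp_chainι_eq F (map_elementOf f.unop).symm
                  (tildeElementOf j.unop ≫ f.unop)
                  (tildeMap f.unop.left.op (elementOf i.unop) ≫ tildeElementOf i.unop)
                  ((Category.id_comp _).trans (Category.comp_id _).symm)
                have h' := NatTrans.naturality (F := chains F) φ f.unop.left.op
                simp only [op_comp, F.map_comp, Category.assoc, ← chainι_map] at h
                simp only [Functor.whiskeringLeft_obj_obj, Functor.comp_map, Category.assoc]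
                erw [reassoc_of% h, h']
                rfl }
          invFun := fun ψ =>
            { app := fun c => chainDesc fun x : X.obj c => ψ.app (op (tilde x))
              naturality := fun c d α => by
                refine chains_hom_ext fun x => ?_
                have h := ψ.naturality (tildeMap α x).op
                erw [chainι_map_assoc, chainι_desc_assoc, chainι_desc]
                exact h }
          left_inv := fun φ => by
            ext c : 2
            refine chains_hom_ext fun x => ?_
            have h := (map_comp_chainι_eq F (elementOf_tilde x) (tildeElementOf (tilde x))
              (𝟙 (tilde x)) rfl).trans
              ((congrArg (· ≫ chainι F x) (F.map_id (op (tilde x)))).trans (Category.id_comp _))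
            erw [chainι_desc]
            exact (Category.assoc _ _ _).symm.trans
              (congrArg (· ≫ NatTrans.app (F := chains F) φ c) h)
          right_inv := fun ψ => by
            ext j : 2
            have h := ψ.naturality (tildeElementOf j.unop).op
            have h' : ((((Functor.whiskeringLeft _ _ _).obj (dimFunctor X)).obj B).map
              (tildeElementOf j.unop).op) = 𝟙 _ := B.map_id _
            exact (congrArg (F.map (tildeElementOf j.unop).op ≫ ·) (chainι_desc
              (M := B.obj (op j.unop.left)) (fun x => ψ.app (op (tilde x)))
              (elementOf j.unop))).trans
              (h.trans ((congrArg (ψ.app j ≫ ·) h').trans (Category.comp_id _))) }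
      homEquiv_naturality_left_symm := fun {F G B} η ψ => by
        ext c : 2
        refine chains_hom_ext fun x => ?_
        erw [chainι_desc, chainι_chainsFunctor_map_app_assoc, chainι_desc]
        rfl
      homEquiv_naturality_right := fun {F B B'} φ β => by
        ext j : 2
        exact ((Category.assoc _ _ _).trans
          (congrArg (F.map (tildeElementOf j.unop).op ≫ ·) (Category.assoc _ _ _))).symm }

/-- Evaluating the chains at a cube amounts to forming a coproduct. -/
noncomputable def chainsFunctorEvaluationIso (c : CubeCatᵒᵖ) :
    (Functor.whiskeringLeft _ _ AddCommGrpCat.{u}).obj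
        (Discrete.functor fun x : X.obj c => op (tilde x)) ⋙ colim ≅
      chainsFunctor X ⋙ (evaluation _ _).obj c :=
  NatIso.ofComponents
    (fun F => HasColimit.isoOfNatIso (Discrete.natIso fun _ => Iso.refl _))
    (fun {F G} η => by
      refine colimit.hom_ext fun ⟨x⟩ => ?_
      have h := chainι_chainsFunctor_map_app η x
      have h₁ (F : (SingularCubes X)ᵒᵖ ⥤ AddCommGrpCat.{u}) :
          colimit.ι (Discrete.functor (fun x : X.obj c => op (tilde x)) ⋙ F) ⟨x⟩ ≫
            (HasColimit.isoOfNatIso (Discrete.natIso (F := Discrete.functor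
              (fun x : X.obj c => op (tilde x)) ⋙ F)
              (G := Discrete.functor fun x : X.obj c => F.obj (op (tilde x)))
              fun _ => Iso.refl _)).hom = chainι F x :=
        (HasColimit.isoOfNatIso_ι_hom _ _).trans (Category.id_comp _)
      refine ((ι_colimMap_assoc _ _ _).trans ?_).trans
        (((congrArg (· ≫ ((chainsFunctor X).map η).app c) (h₁ F)).trans h).symm.trans
          (Category.assoc _ _ _))
      exact congrArg (η.app (op (tilde x)) ≫ ·) (h₁ G))

instance : (chainsFunctor X).Additive :=
  (chainsAdjunction X).left_adjoint_additive

/-- At a fixed cube the chains are a coproduct of evaluations at singular cubes, and both evaluation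
and coproducts of Abelian groups are exact. -/
theorem chains_shortExact {S : ShortComplex ((SingularCubes X)ᵒᵖ ⥤ AddCommGrpCat.{u})}
    (hS : S.ShortExact) (c : CubeCatᵒᵖ) :
    (S.map (chainsFunctor X ⋙ (evaluation _ _).obj c)).ShortExact := by
  have := chainsFunctorEvaluationIso (X := X) c
  have h : (S.map ((Functor.whiskeringLeft _ _ AddCommGrpCat.{u}).obj
        (Discrete.functor fun x : X.obj c => op (tilde x)) ⋙ colim)).ShortExact := by
    exact hS.map_of_exact _
  refine ShortComplex.shortExact_of_iso (S.mapNatIso this) h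

end ChainsAdjunction

/-! ### Functoriality of the normalized complex -/

section NormalizedFunctor

variable {A B : CubeCatᵒᵖ ⥤ AddCommGrpCat.{u}}

theorem faceDiff_naturality (φ : A ⟶ B) {k : ℕ} (i : Fin (k + 1)) :
    faceDiff A i ≫ φ.app _ = φ.app _ ≫ faceDiff B i := by
  simp [faceDiff, Preadditive.sub_comp, Preadditive.comp_sub]

theorem diff_naturality (φ : A ⟶ B) (k : ℕ) :
    diff A k ≫ φ.app _ = φ.app _ ≫ diff B k := by
  simp only [diff, Preadditive.sum_comp, Preadditive.comp_sum, Preadditive.zsmul_comp,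
    Preadditive.comp_zsmul, faceDiff_naturality]

theorem degenerate_le_comap_app (φ : A ⟶ B) (k : ℕ) :
    degenerate A k ≤ (degenerate B k).comap (φ.app (op (cube k))).hom := by
  cases k with
  | zero => exact bot_le
  | succ k =>
    refine iSup_le fun j => ?_
    rintro _ ⟨y, rfl⟩
    exact AddSubgroup.mem_iSup_of_mem j ⟨(φ.app (op (cube k))).hom y,
      (ConcreteCategory.congr_hom (φ.naturality (degen j).op) y).symm⟩

/-- The map of the normalized chains induced by a morphism of cubical groups. -/
def normalizedApp (φ : A ⟶ B) (k : ℕ) :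
    AddCommGrpCat.of (A.obj (op (cube k)) ⧸ degenerate A k) ⟶
      AddCommGrpCat.of (B.obj (op (cube k)) ⧸ degenerate B k) :=
  AddCommGrpCat.ofHom (QuotientAddGroup.map _ _ (φ.app (op (cube k))).hom
    (degenerate_le_comap_app φ k))

/-- The projection of the chains to the normalized chains. -/
def normalizedMk (A : CubeCatᵒᵖ ⥤ AddCommGrpCat.{u}) (k : ℕ) :
    A.obj (op (cube k)) ⟶ AddCommGrpCat.of (A.obj (op (cube k)) ⧸ degenerate A k) :=
  AddCommGrpCat.ofHom (QuotientAddGroup.mk' (degenerate A k))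

instance (A : CubeCatᵒᵖ ⥤ AddCommGrpCat.{u}) (k : ℕ) : Epi (normalizedMk A k) :=
  (AddCommGrpCat.epi_iff_surjective _).2 (QuotientAddGroup.mk'_surjective _)

theorem normalizedMk_app (φ : A ⟶ B) (k : ℕ) :
    normalizedMk A k ≫ normalizedApp φ k = φ.app _ ≫ normalizedMk B k := rfl

theorem normalizedMk_diff (A : CubeCatᵒᵖ ⥤ AddCommGrpCat.{u}) (k : ℕ) :
    normalizedMk A (k + 1) ≫ normalizedDiff A k = diff A k ≫ normalizedMk A k := rfl

theorem normalizedComplex_d (A : CubeCatᵒᵖ ⥤ AddCommGrpCat.{u}) (k : ℕ) :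
    (normalizedComplex A).d (k + 1) k = normalizedDiff A k :=
  ChainComplex.of_d (fun k => AddCommGrpCat.of (A.obj (op (cube k)) ⧸ degenerate A k))
    (normalizedDiff A) k

theorem normalizedApp_diff (φ : A ⟶ B) (k : ℕ) :
    normalizedApp φ (k + 1) ≫ normalizedDiff B k = normalizedDiff A k ≫ normalizedApp φ k := by
  rw [← cancel_epi (normalizedMk A (k + 1)), ← Category.assoc, ← Category.assoc,
    normalizedMk_app, normalizedMk_diff, Category.assoc, Category.assoc, normalizedMk_app,
    normalizedMk_diff, ← Category.assoc, ← Category.assoc, diff_naturality]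

/-- The normalized complex as a functor on cubical Abelian groups. -/
noncomputable def normalizedFunctor :
    (CubeCatᵒᵖ ⥤ AddCommGrpCat.{u}) ⥤ ChainComplex AddCommGrpCat.{u} ℕ where
  obj A := normalizedComplex A
  map {A B} φ := ChainComplex.ofHom (X := normalizedComplex A) (Y := normalizedComplex B)
    (normalizedApp φ) (fun k => by
      rw [normalizedComplex_d, normalizedComplex_d]
      exact normalizedApp_diff φ k)
  map_id A := by
    ext k : 1
    exact (cancel_epi (normalizedMk A k)).1 rfl
  map_comp {A B C} φ ψ := by
    ext k : 1
    exact (cancel_epi (normalizedMk A k)).1 rfl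

/-- The projection of the chains to the terms of the normalized complex. -/
def normalizedπ (A : CubeCatᵒᵖ ⥤ AddCommGrpCat.{u}) (k : ℕ) :
    A.obj (op (cube k)) ⟶ (normalizedComplex A).X k :=
  normalizedMk A k

instance (A : CubeCatᵒᵖ ⥤ AddCommGrpCat.{u}) (k : ℕ) : Epi (normalizedπ A k) :=
  inferInstanceAs (Epi (normalizedMk A k))

theorem normalizedπ_d (A : CubeCatᵒᵖ ⥤ AddCommGrpCat.{u}) (k : ℕ) :
    normalizedπ A (k + 1) ≫ (normalizedComplex A).d (k + 1) k = diff A k ≫ normalizedπ A k := by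
  rw [normalizedComplex_d]
  rfl

theorem normalizedπ_naturality (φ : A ⟶ B) (k : ℕ) :
    normalizedπ A k ≫ (normalizedFunctor.map φ).f k = φ.app _ ≫ normalizedπ B k := rfl

instance : (normalizedFunctor.{u}).Additive where
  map_add {A B φ ψ} := by
    ext k : 1
    exact (cancel_epi (normalizedMk A k)).1 rfl

end NormalizedFunctor

/-! ### Natural splitting of the degenerate chains, and exactness of normalization -/

section Idempotent

variable (A : CubeCatᵒᵖ ⥤ AddCommGrpCat.{u})

/-- The morphism of cubes that sets a coordinate to zero. -/
def reset {k : ℕ} (i : Fin (k + 1)) : cube (k + 1) ⟶ cube (k + 1) :=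
  degen i ≫ face i false

theorem reset_apply {k : ℕ} (i : Fin (k + 1)) (x : Pt (k + 1)) :
    (reset i).1 x = Function.update x i false := by
  change i.insertNth (α := fun _ => Bool) false (i.removeNth x) = _
  simp

theorem reset_comm {k : ℕ} (i j : Fin (k + 1)) : reset i ≫ reset j = reset j ≫ reset i := by
  apply Subtype.ext
  apply OrderHom.ext
  funext x
  change (reset j).1 ((reset i).1 x) = (reset i).1 ((reset j).1 x)
  rw [reset_apply, reset_apply, reset_apply, reset_apply]
  rcases eq_or_ne i j with rfl | h
  · rfl
  · exact Function.update_comm h _ _ _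

/-- The product of the operators `1 - uᵢ`, where `uᵢ` sets the `i`-th coordinate to zero. -/
def strip {k : ℕ} : List (Fin (k + 1)) → (A.obj (op (cube (k + 1))) ⟶ A.obj (op (cube (k + 1))))
  | [] => 𝟙 _
  | i :: l => strip l ≫ (𝟙 _ - A.map (reset i).op)

theorem strip_comm {k : ℕ} (i : Fin (k + 1)) (l : List (Fin (k + 1))) :
    A.map (reset i).op ≫ strip A l = strip A l ≫ A.map (reset i).op := by
  induction l with
  | nil => simp [strip]
  | cons j l ih =>
    simp only [strip, Preadditive.comp_sub, Preadditive.sub_comp, Category.comp_id, ih,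
      Category.assoc, ← A.map_comp, ← op_comp]
    rw [← Category.assoc, ih, Category.assoc, ← A.map_comp, ← op_comp, reset_comm j i]

/-- Elements in the image of the `i`-th degeneracy operator are fixed by `uᵢ`, since the face is a
section of the degeneracy; hence `1 - uᵢ` kills them. As the factors commute, this factor may be
applied first. -/
theorem degen_strip {k : ℕ} {i : Fin (k + 1)} {l : List (Fin (k + 1))} (h : i ∈ l) :
    A.map (degen i).op ≫ strip A l = 0 := by
  induction l with
  | nil => simp at h
  | cons j l ih =>
    rw [strip]
    rcases List.mem_cons.1 h with rfl | h
    · rw [Preadditive.comp_sub, ← strip_comm, Preadditive.comp_sub, Category.comp_id,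
        ← Category.assoc, ← A.map_comp, ← op_comp, reset, Category.assoc, face_comp_degen_self]
      simp
    · rw [← Category.assoc, ih h, zero_comp]

/-- Each `uⱼ` factors through the `j`-th degeneracy operator, so every factor `1 - uⱼ` changes a
chain only by a degenerate one. -/
theorem sub_strip_mem {k : ℕ} (l : List (Fin (k + 1))) (x : A.obj (op (cube (k + 1)))) :
    x - (strip A l).hom x ∈ degenerate A (k + 1) := by
  induction l with
  | nil => simp [strip]
  | cons j l ih =>
    have h : (strip A (j :: l)).hom x =
      (strip A l).hom x - (A.map (degen j).op).hom ((A.map (face j false).op).hom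
        ((strip A l).hom x)) := by
      have : A.map (reset j).op = A.map (face j false).op ≫ A.map (degen j).op := by
        rw [← A.map_comp, ← op_comp, reset]
      rw [strip, this]
      rfl
    rw [h, ← sub_add]
    exact add_mem ih (AddSubgroup.mem_iSup_of_mem j ⟨_, rfl⟩)

theorem strip_naturality {A B : CubeCatᵒᵖ ⥤ AddCommGrpCat.{u}} (φ : A ⟶ B) {k : ℕ}
    (l : List (Fin (k + 1))) : strip A l ≫ φ.app _ = φ.app _ ≫ strip B l := by
  induction l with
  | nil => simp [strip]
  | cons j l ih =>
    simp only [strip, Category.assoc, Preadditive.sub_comp, Preadditive.comp_sub,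
      Category.comp_id, ih, NatTrans.naturality]
    rw [← Category.assoc, ih, Category.assoc]

/-- A natural endomorphism of the chains that vanishes on the degenerate chains and is the identity
modulo them. -/
def strippedPart : (k : ℕ) → (A.obj (op (cube k)) ⟶ A.obj (op (cube k)))
  | 0 => 𝟙 _
  | k + 1 => strip A (List.finRange (k + 1))

theorem strippedPart_eq_zero (k : ℕ) {x : A.obj (op (cube k))} (hx : x ∈ degenerate A k) :
    (strippedPart A k).hom x = 0 := by
  cases k with
  | zero => exact hx
  | succ k =>
    suffices h : degenerate A (k + 1) ≤ (strippedPart A (k + 1)).hom.ker from h hx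
    refine iSup_le fun j => ?_
    rintro _ ⟨y, rfl⟩
    exact ConcreteCategory.congr_hom (degen_strip A (List.mem_finRange j)) y

theorem sub_strippedPart_mem (k : ℕ) (x : A.obj (op (cube k))) :
    x - (strippedPart A k).hom x ∈ degenerate A k := by
  cases k with
  | zero => exact (AddSubgroup.mem_bot).2 (sub_self x)
  | succ k => exact sub_strip_mem A _ x

theorem strippedPart_naturality {A B : CubeCatᵒᵖ ⥤ AddCommGrpCat.{u}} (φ : A ⟶ B) (k : ℕ)
    (x : A.obj (op (cube k))) :
    (φ.app _).hom ((strippedPart A k).hom x) = (strippedPart B k).hom ((φ.app _).hom x) := by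
  cases k with
  | zero => rfl
  | succ k => exact ConcreteCategory.congr_hom (strip_naturality φ _) x

end Idempotent

/-- The normalized complex is an exact functor. -/
theorem normalizedFunctor_shortExact (S : ShortComplex (CubeCatᵒᵖ ⥤ AddCommGrpCat.{u}))
    (hS : ∀ c, (S.map ((evaluation _ _).obj c)).ShortExact) :
    (S.map normalizedFunctor).ShortExact := by
  refine HomologicalComplex.shortExact_of_degreewise_shortExact _ fun k => ?_
  have hS := hS (op (cube k))
  have hinj : Function.Injective (S.f.app (op (cube k))).hom := hS.ab_injective_f
  have hsurj : Function.Surjective (S.g.app (op (cube k))).hom := hS.ab_surjective_g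
  have hex : ∀ x, (S.g.app (op (cube k))).hom x = 0 → ∃ y, (S.f.app (op (cube k))).hom y = x :=
    (ShortComplex.ab_exact_iff _).1 hS.exact
  refine ShortComplex.ShortExact.mk' ((ShortComplex.ab_exact_iff _).2 ?_)
    ((AddCommGrpCat.mono_iff_injective _).2 ?_) ((AddCommGrpCat.epi_iff_surjective _).2 ?_)
  · intro x hx
    obtain ⟨x, rfl⟩ := QuotientAddGroup.mk_surjective x
    have hx : (S.g.app (op (cube k))).hom x ∈ degenerate S.X₃ k :=
      (QuotientAddGroup.eq_zero_iff _).1 hx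
    -- The image of `x` is only degenerate, not zero. The stripped representative of the same class
    -- is mapped to zero on the nose, so exactness of the unnormalized sequence applies to it.
    obtain ⟨y, hy⟩ := hex ((strippedPart S.X₂ k).hom x) (by
      rw [strippedPart_naturality, strippedPart_eq_zero _ _ hx])
    refine ⟨QuotientAddGroup.mk y, ?_⟩
    refine (congrArg (QuotientAddGroup.mk (s := degenerate S.X₂ k)) hy).trans ?_
    refine (QuotientAddGroup.eq (s := degenerate S.X₂ k)).2 ?_
    rw [neg_add_eq_sub]
    exact sub_strippedPart_mem _ _ _
  · refine (injective_iff_map_eq_zero (normalizedApp S.f k).hom).2 fun x hx => ?_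
    obtain ⟨x, rfl⟩ := QuotientAddGroup.mk_surjective x
    have hx : (S.f.app (op (cube k))).hom x ∈ degenerate S.X₂ k :=
      (QuotientAddGroup.eq_zero_iff _).1 hx
    -- By naturality the stripped part of `x` is mapped to zero, hence is zero by injectivity; then
    -- `x` is degenerate.
    have h := strippedPart_eq_zero _ _ hx
    rw [← strippedPart_naturality, ← map_zero (S.f.app (op (cube k))).hom] at h
    have h' := sub_strippedPart_mem S.X₁ k x
    rw [hinj h, sub_zero] at h'
    exact (QuotientAddGroup.eq_zero_iff _).2 h'
  · intro x
    obtain ⟨x, rfl⟩ := QuotientAddGroup.mk_surjective x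
    obtain ⟨y, rfl⟩ := hsurj x
    exact ⟨QuotientAddGroup.mk y, rfl⟩

/-! ### Cylinders of morphisms of cubes -/

section Cylinder

theorem cube_hom_ext {n m : ℕ} {f g : cube n ⟶ cube m} (h : ∀ x : Pt n, f.1 x = g.1 x) : f = g :=
  Subtype.ext (OrderHom.ext _ _ (funext h))

theorem comp_apply {n m k : ℕ} (f : cube n ⟶ cube m) (g : cube m ⟶ cube k) (x : Pt n) :
    (f ≫ g).1 x = g.1 (f.1 x) := rfl

theorem face_last_apply {k : ℕ} (τ : Bool) (x : Pt k) :
    (face (Fin.last k) τ).1 x = Fin.snoc (α := fun _ => Bool) x τ :=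
  Fin.insertNth_last' τ x

theorem degen_last_apply {k : ℕ} (x : Pt (k + 1)) :
    (degen (Fin.last k)).1 x = Fin.init (α := fun _ => Bool) x :=
  Fin.removeNth_last x

/-- The product of a monotone map with the identity of the interval, as a new last coordinate. -/
def cylMap {n m : ℕ} (f : Pt n →o Pt m) : Pt (n + 1) →o Pt (m + 1) where
  toFun x := Fin.snoc (α := fun _ => Bool) (f (Fin.init (α := fun _ => Bool) x)) (x (Fin.last n))
  monotone' x y h := by
    intro j
    refine Fin.lastCases ?_ (fun j => ?_) j
    · simpa using h _
    · beta_reduce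
      rw [Fin.snoc_castSucc, Fin.snoc_castSucc]
      exact f.monotone (fun i => h i.castSucc) j

theorem cylMap_apply {n m : ℕ} (f : Pt n →o Pt m) (x : Pt (n + 1)) :
    cylMap f x = Fin.snoc (α := fun _ => Bool) (f (Fin.init (α := fun _ => Bool) x))
      (x (Fin.last n)) := rfl

theorem cylMap_face {k : ℕ} (i : Fin (k + 1)) (τ : Bool) :
    cylMap (faceMap i τ) = faceMap i.castSucc τ := by
  apply OrderHom.ext
  funext x
  change Fin.snoc (α := fun _ => Bool) (i.insertNth (α := fun _ => Bool) τ
    (Fin.init (α := fun _ => Bool) x)) (x (Fin.last k)) =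
      i.castSucc.insertNth (α := fun _ => Bool) τ x
  refine Eq.symm ((Fin.insertNth_eq_iff).2 ⟨by simp, ?_⟩)
  funext j
  refine Fin.lastCases ?_ (fun j => ?_) j
  · simp [Fin.removeNth]
  · simp [Fin.removeNth, Fin.init]

theorem cylMap_degen {k : ℕ} (i : Fin (k + 1)) :
    cylMap (degenMap i) = degenMap i.castSucc := by
  apply OrderHom.ext
  funext x
  change Fin.snoc (α := fun _ => Bool) (i.removeNth
    (Fin.init (α := fun _ => Bool) x)) (x (Fin.last _)) = i.castSucc.removeNth x
  funext j
  refine Fin.lastCases ?_ (fun j => ?_) j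
  · simp [Fin.removeNth]
  · simp [Fin.removeNth, Fin.init]

/-- Multiplication by the interval takes the generators to generators and respects composition; with
the new coordinate in the last place, the old indices keep their values. -/
theorem IsCubeMap.cyl {n m : ℕ} {f : Pt n →o Pt m} (hf : IsCubeMap f) : IsCubeMap (cylMap f) := by
  induction hf with
  | id n =>
    convert IsCubeMap.id (n + 1)
    apply OrderHom.ext
    funext x
    simp [cylMap_apply]
  | face i τ => exact cylMap_face i τ ▸ IsCubeMap.face _ _
  | degen i => exact cylMap_degen i ▸ IsCubeMap.degen _
  | @comp p q r f g _ _ hf hg =>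
    convert IsCubeMap.comp hf hg
    apply OrderHom.ext
    funext x
    simp [cylMap_apply]

/-- The product of a morphism of cubes with the identity of the interval, as a new last
coordinate. -/
def cyl {n m : ℕ} (f : cube n ⟶ cube m) : cube (n + 1) ⟶ cube (m + 1) :=
  ⟨cylMap f.1, IsCubeMap.cyl f.2⟩

theorem cyl_apply {n m : ℕ} (f : cube n ⟶ cube m) (x : Pt (n + 1)) :
    (cyl f).1 x = Fin.snoc (α := fun _ => Bool) (f.1 (Fin.init (α := fun _ => Bool) x))
      (x (Fin.last n)) := rfl

theorem cyl_comp {n m k : ℕ} (f : cube n ⟶ cube m) (g : cube m ⟶ cube k) :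
    cyl (f ≫ g) = cyl f ≫ cyl g := by
  refine cube_hom_ext fun x => ?_
  rw [comp_apply, cyl_apply, cyl_apply, cyl_apply, comp_apply]
  simp

theorem cyl_face {k : ℕ} (i : Fin (k + 1)) (τ : Bool) : cyl (face i τ) = face i.castSucc τ :=
  Subtype.ext (cylMap_face i τ)

theorem cyl_degen {k : ℕ} (i : Fin (k + 1)) : cyl (degen i) = degen i.castSucc :=
  Subtype.ext (cylMap_degen i)

theorem face_last_cyl {n m : ℕ} (f : cube n ⟶ cube m) (τ : Bool) :
    face (Fin.last n) τ ≫ cyl f = f ≫ face (Fin.last m) τ := by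
  refine cube_hom_ext fun x => ?_
  rw [comp_apply, comp_apply, face_last_apply, face_last_apply, cyl_apply]
  simp

theorem cyl_degen_last {n m : ℕ} (f : cube n ⟶ cube m) :
    cyl f ≫ degen (Fin.last m) = degen (Fin.last n) ≫ f := by
  refine cube_hom_ext fun x => ?_
  rw [comp_apply, comp_apply, degen_last_apply, degen_last_apply, cyl_apply]
  simp

theorem eq_comp_face_last {n m : ℕ} {f : cube n ⟶ cube (m + 1)} {τ : Bool}
    (h : ∀ x, f.1 x (Fin.last m) = τ) : f = (f ≫ degen (Fin.last m)) ≫ face (Fin.last m) τ := by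
  refine cube_hom_ext fun x => ?_
  rw [comp_apply, comp_apply, face_last_apply, degen_last_apply, ← h x, Fin.snoc_init_self]

end Cylinder

/-! ### Degree zero: homology is the colimit -/

section Vertices

variable (A : CubeCatᵒᵖ ⥤ AddCommGrpCat.{u})

/-- A homomorphism that identifies the two ends of every edge identifies all vertices of a cube,
because the graph of its edges is connected. -/
theorem map_vertex_comp_eq {M : AddCommGrpCat.{u}} (q : A.obj (op (cube 0)) ⟶ M)
    (hq : diff A 0 ≫ q = 0) {m : ℕ} (f g : cube 0 ⟶ cube m) :
    A.map f.op ≫ q = A.map g.op ≫ q := by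
  have hq' : A.map (face (Fin.last 0) false).op ≫ q = A.map (face (Fin.last 0) true).op ≫ q := by
    have : diff A 0 = -faceDiff A (Fin.last 0) := by simp [diff]
    rw [this, faceDiff, Preadditive.neg_comp, neg_eq_zero, Preadditive.sub_comp, sub_eq_zero] at hq
    exact hq
  induction m with
  | zero =>
    congr 3
    exact cube_hom_ext fun x => funext fun j => j.elim0
  | succ m ih =>
    have key (τ σ : Bool) (f g : cube 0 ⟶ cube m) :
        A.map (f ≫ face (Fin.last m) τ).op ≫ q = A.map (g ≫ face (Fin.last m) σ).op ≫ q := by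
      -- The last coordinate is changed along the edge `cyl f`; the remaining coordinates are then
      -- handled by induction in the facet.
      have h : A.map (f ≫ face (Fin.last m) τ).op ≫ q = A.map (f ≫ face (Fin.last m) σ).op ≫ q := by
        rw [← face_last_cyl, ← face_last_cyl, op_comp, op_comp, A.map_comp, A.map_comp,
          Category.assoc, Category.assoc]
        cases τ <;> cases σ <;> simp only [hq']
      rw [h, op_comp, op_comp, A.map_comp, A.map_comp, Category.assoc, Category.assoc, ih f g]
    have hf (f : cube 0 ⟶ cube (m + 1)) : ∃ (τ : Bool) (f' : cube 0 ⟶ cube m),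
        f = f' ≫ face (Fin.last m) τ :=
      ⟨f.1 Fin.elim0 (Fin.last m), f ≫ degen (Fin.last m), eq_comp_face_last fun x => by
        rw [Subsingleton.elim x Fin.elim0]⟩
    obtain ⟨τ, f, rfl⟩ := hf f
    obtain ⟨σ, g, rfl⟩ := hf g
    exact key τ σ f g

/-- The vertex of a cube with all coordinates zero. -/
def vertex : (m : ℕ) → (cube 0 ⟶ cube m)
  | 0 => 𝟙 _
  | m + 1 => vertex m ≫ face (Fin.last m) false

/-- The projection of the `0`-chains to the homology classes. -/
noncomputable def zeroClass : A.obj (op (cube 0)) ⟶ (normalizedComplex A).opcycles 0 :=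
  normalizedπ A 0 ≫ (normalizedComplex A).pOpcycles 0

theorem diff_zeroClass : diff A 0 ≫ zeroClass A = 0 := by
  rw [zeroClass, ← Category.assoc, ← normalizedπ_d, Category.assoc,
    HomologicalComplex.d_pOpcycles, comp_zero]

theorem zeroClass_hom_ext {M : AddCommGrpCat.{u}} {f g : (normalizedComplex A).opcycles 0 ⟶ M}
    (h : zeroClass A ≫ f = zeroClass A ≫ g) : f = g := by
  rw [zeroClass, Category.assoc, Category.assoc] at h
  exact (cancel_epi ((normalizedComplex A).pOpcycles 0)).1 ((cancel_epi (normalizedπ A 0)).1 h)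

theorem zeroClass_naturality {A B : CubeCatᵒᵖ ⥤ AddCommGrpCat.{u}} (φ : A ⟶ B) :
    zeroClass A ≫ HomologicalComplex.opcyclesMap (normalizedFunctor.map φ) 0 =
      φ.app (op (cube 0)) ≫ zeroClass B := by
  rw [zeroClass, zeroClass, ← Category.assoc, ← normalizedπ_naturality]
  exact (Category.assoc _ _ _).trans ((congrArg (normalizedπ A 0 ≫ ·)
    (HomologicalComplex.p_opcyclesMap _ _)).trans (Category.assoc _ _ _).symm)

/-- There are no degenerate `0`-chains, so `q` is already defined on normalized `0`-chains, and
vanishing on boundaries can be tested before passing to normalized `1`-chains. -/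
theorem exists_zeroClass_desc {M : AddCommGrpCat.{u}} (q : A.obj (op (cube 0)) ⟶ M)
    (hq : diff A 0 ≫ q = 0) : ∃ f, zeroClass A ≫ f = q := by
  let q' : (normalizedComplex A).X 0 ⟶ M :=
    AddCommGrpCat.ofHom (QuotientAddGroup.lift _ q.hom (bot_le : (⊥ : AddSubgroup _) ≤ _))
  have hq' : normalizedπ A 0 ≫ q' = q := rfl
  refine ⟨(normalizedComplex A).descOpcycles (i := 0) q' 1 (by simp) ?_, ?_⟩
  · rw [← cancel_epi (normalizedπ A 1), ← Category.assoc, normalizedπ_d,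
      Category.assoc, hq', hq, comp_zero]
  · rw [zeroClass, Category.assoc, HomologicalComplex.p_descOpcycles, hq']

/-- The cocone on a cubical group given by its homology in degree zero. -/
noncomputable def zeroCocone : Cocone A where
  pt := (normalizedComplex A).opcycles 0
  ι :=
    { app := fun c => A.map (vertex c.unop.dim).op ≫ zeroClass A
      naturality := fun c d α => by
        refine Eq.trans ?_ (Category.comp_id _).symm
        rw [← Category.assoc, ← A.map_comp]
        -- Compatibility with `α` compares two vertices of the same cube: the image under `α` of the
        -- zero vertex and the zero vertex itself.
        exact map_vertex_comp_eq A _ (diff_zeroClass A) (vertex d.unop.dim ≫ α.unop) _ }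

/-- The homology of the normalized complex in degree zero is the colimit of the cubical group. -/
noncomputable def isColimitZeroCocone : IsColimit (zeroCocone A) where
  -- The leg of a cocone at the point equalizes the two face operators from dimension one, since
  -- both composites are the leg at the interval.
  desc s := (exists_zeroClass_desc A (s.ι.app (op (cube 0))) (by
    simp [diff, faceDiff, Preadditive.sub_comp])).choose
  fac s c := by
    have h := (exists_zeroClass_desc A (s.ι.app (op (cube 0))) (by
      simp [diff, faceDiff, Preadditive.sub_comp])).choose_spec
    refine (Category.assoc _ _ _).trans ((congrArg (A.map (vertex c.unop.dim).op ≫ ·) h).trans ?_)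
    exact s.w _
  uniq s f hf := by
    refine zeroClass_hom_ext A ?_
    have h := (exists_zeroClass_desc A (s.ι.app (op (cube 0))) (by
      simp [diff, faceDiff, Preadditive.sub_comp])).choose_spec
    rw [h, ← hf]
    exact ((congrArg (· ≫ f) ((congrArg (· ≫ zeroClass A) (A.map_id _)).trans
      (Category.id_comp _))).symm)

/-- The colimit of a cubical group as the opcycles of its normalized complex in degree zero. -/
noncomputable def zeroIso : colimit A ≅ (normalizedComplex A).opcycles 0 :=
  (colimit.isColimit A).coconePointUniqueUpToIso (isColimitZeroCocone A)

theorem ι_zeroIso_hom (c : CubeCatᵒᵖ) :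
    colimit.ι A c ≫ (zeroIso A).hom = A.map (vertex c.unop.dim).op ≫ zeroClass A :=
  (colimit.isColimit A).comp_coconePointUniqueUpToIso_hom (isColimitZeroCocone A) c

theorem zeroIso_naturality {A B : CubeCatᵒᵖ ⥤ AddCommGrpCat.{u}} (φ : A ⟶ B) :
    colimMap φ ≫ (zeroIso B).hom =
      (zeroIso A).hom ≫ HomologicalComplex.opcyclesMap (normalizedFunctor.map φ) 0 := by
  refine colimit.hom_ext fun c => ?_
  rw [ι_colimMap_assoc, ι_zeroIso_hom]
  refine Eq.trans ?_ (Category.assoc _ _ _)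
  rw [ι_zeroIso_hom]
  refine Eq.trans ?_ ((congrArg (A.map (vertex c.unop.dim).op ≫ ·)
    (zeroClass_naturality φ)).symm.trans (Category.assoc _ _ _).symm)
  exact (φ.naturality_assoc _ _).symm

/-- The homology of the normalized complex in degree zero is the colimit functor. -/
noncomputable def normalizedHomologyZeroIso :
    normalizedFunctor ⋙ HomologicalComplex.homologyFunctor AddCommGrpCat.{u} _ 0 ≅
      (colim : (CubeCatᵒᵖ ⥤ AddCommGrpCat.{u}) ⥤ AddCommGrpCat.{u}) :=
  Iso.symm (NatIso.ofComponents (fun A => zeroIso A ≪≫ (normalizedComplex A).isoHomologyι₀.symm)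
    (fun {A B} φ => by
      have h : (normalizedComplex A).isoHomologyι₀.inv ≫
          HomologicalComplex.homologyMap (normalizedFunctor.map φ) 0 =
            HomologicalComplex.opcyclesMap (normalizedFunctor.map φ) 0 ≫
              (normalizedComplex B).isoHomologyι₀.inv :=
        ChainComplex.isoHomologyι₀_inv_naturality _
      change colimMap φ ≫ (zeroIso B).hom ≫ (normalizedComplex B).isoHomologyι₀.inv =
        ((zeroIso A).hom ≫ (normalizedComplex A).isoHomologyι₀.inv) ≫
          HomologicalComplex.homologyMap (normalizedFunctor.map φ) 0
      refine Eq.trans ?_ ((congrArg ((zeroIso A).hom ≫ ·) h).symm.trans (Category.assoc _ _ _).symm)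
      rw [← Category.assoc, zeroIso_naturality]
      exact Category.assoc _ _ _))

end Vertices

/-! ### Normal form of morphisms of cubes -/

section Trichotomy

/-- Each coordinate of a morphism of cubes is constant or a variable, and the variables occur in
increasing order. -/
theorem IsCubeMap.exists_coordinates {p q : ℕ} {f : Pt p →o Pt q} (hf : IsCubeMap f) :
    ∃ c : Fin q → Bool ⊕ Fin p, (∀ x j, f x j = Sum.elim (fun b => b) x (c j)) ∧
      ∀ j j' i i', c j = Sum.inr i → c j' = Sum.inr i' → j < j' → i < i' := by
  induction hf with
  | id n =>
    refine ⟨Sum.inr, fun x j => rfl, fun j j' i i' h h' hj => ?_⟩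
    rwa [← Sum.inr_injective h, ← Sum.inr_injective h']
  | @face k i τ =>
    refine ⟨i.insertNth (α := fun _ => Bool ⊕ Fin k) (Sum.inl τ) Sum.inr, fun x j => ?_, ?_⟩
    · change i.insertNth (α := fun _ => Bool) τ x j = _
      refine Fin.succAboveCases i ?_ (fun j => ?_) j <;> simp
    · intro j j' a a'
      refine Fin.succAboveCases i ?_ (fun j => ?_) j
      · simp
      refine Fin.succAboveCases i ?_ (fun j' => ?_) j'
      · simp
      simp only [Fin.insertNth_apply_succAbove, Sum.inr.injEq, Fin.succAbove_lt_succAbove_iff]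
      rintro rfl rfl h
      exact h
  | @degen k i =>
    refine ⟨fun j => Sum.inr (i.succAbove j), fun x j => rfl, fun j j' a a' h h' hj => ?_⟩
    rw [← Sum.inr_injective h, ← Sum.inr_injective h']
    exact Fin.succAbove_lt_succAbove_iff.2 hj
  | @comp p q r f g _ _ hf hg =>
    obtain ⟨c, hc, hc'⟩ := hf
    obtain ⟨d, hd, hd'⟩ := hg
    refine ⟨fun j => Sum.elim Sum.inl c (d j), fun x j => ?_, fun j j' i i' => ?_⟩
    · change g (f x) j = _
      rw [hd]
      beta_reduce
      cases d j with
      | inl b => rfl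
      | inr a => exact hc x a
    · dsimp only
      cases h : d j with
      | inl b => simp
      | inr a =>
        cases h' : d j' with
        | inl b => simp
        | inr a' =>
          intro hi hi' hj
          exact hc' a a' i i' hi hi' (hd' j j' a a' h h' hj)

/-- The last coordinate of a morphism of cubes is constant, or the last variable does not occur, or
the last coordinate is the last variable. -/
theorem last_coordinate_cases {n m : ℕ} (f : cube (n + 1) ⟶ cube (m + 1)) :
    (∃ τ, ∀ x, f.1 x (Fin.last m) = τ) ∨
      (f = degen (Fin.last n) ≫ face (Fin.last n) false ≫ f) ∨
      ∃ g : cube n ⟶ cube m, f = cyl g := by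
  obtain ⟨c, hc, hc'⟩ := f.2.exists_coordinates
  -- A coordinate other than the last variable is unaffected by setting the last variable to
  -- `false`.
  have heval (x : Pt (n + 1)) (j : Fin (m + 1)) (h : c j ≠ Sum.inr (Fin.last n)) :
      f.1 x j = f.1 (Fin.snoc (α := fun _ => Bool) (Fin.init (α := fun _ => Bool) x) false) j := by
    rw [hc, hc]
    cases hj : c j with
    | inl b => rfl
    | inr a =>
      obtain ⟨a, rfl⟩ := Fin.exists_castSucc_eq.2 (fun ha => h (hj.trans (congrArg _ ha)))
      simp [Fin.init]
  cases h : c (Fin.last m) with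
  | inl τ =>
    refine Or.inl ⟨τ, fun x => ?_⟩
    rw [hc, h]
    rfl
  | inr i =>
    rcases eq_or_ne i (Fin.last n) with rfl | hi
    · refine Or.inr (Or.inr ⟨face (Fin.last n) false ≫ f ≫ degen (Fin.last m), ?_⟩)
      refine cube_hom_ext fun x => funext fun j => ?_
      rw [cyl_apply, comp_apply, comp_apply, face_last_apply, degen_last_apply]
      refine Fin.lastCases ?_ (fun j => ?_) j
      · rw [hc, h, Fin.snoc_last]
        rfl
      · rw [Fin.snoc_castSucc]
        -- The last variable already occurs in the last coordinate, so by strict monotonicity no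
        -- earlier coordinate involves it.
        exact heval x _ fun hj => lt_irrefl _ (hc' _ _ _ _ hj h (Fin.castSucc_lt_last j))
    · refine Or.inr (Or.inl ?_)
      refine cube_hom_ext fun x => funext fun j => ?_
      rw [comp_apply, comp_apply, degen_last_apply, face_last_apply]
      -- If the last variable occurred in an earlier coordinate, the variable `i` in the last
      -- coordinate would have to be larger still.
      refine heval x j fun hj => ?_
      rcases eq_or_ne j (Fin.last m) with rfl | hjm
      · exact hi (Sum.inr_injective (h.symm.trans hj))
      · exact absurd (hc' _ _ _ _ hj h (Fin.lt_last_iff_ne_last.2 hjm)) (Fin.le_last i).not_gt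

end Trichotomy

/-! ### Acyclic cubical groups: retracts and coproducts -/

section Acyclic

variable {A B : CubeCatᵒᵖ ⥤ AddCommGrpCat.{u}}

theorem degen_normalizedMk (A : CubeCatᵒᵖ ⥤ AddCommGrpCat.{u}) {k : ℕ} (i : Fin (k + 1)) :
    A.map (degen i).op ≫ normalizedMk A (k + 1) = 0 := by
  ext x
  exact (QuotientAddGroup.eq_zero_iff _).2 (AddSubgroup.mem_iSup_of_mem i ⟨x, rfl⟩)

/-- The normalized complex is exact in positive degrees. -/
def IsAcyclic (A : CubeCatᵒᵖ ⥤ AddCommGrpCat.{u}) : Prop :=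
  ∀ (n : ℕ) (z : AddCommGrpCat.of (A.obj (op (cube (n + 1))) ⧸ degenerate A (n + 1))),
    (normalizedDiff A n).hom z = 0 → ∃ w, (normalizedDiff A (n + 1)).hom w = z

theorem IsAcyclic.isZero_homology (h : IsAcyclic A) (n : ℕ) :
    IsZero ((normalizedComplex A).homology (n + 1)) := by
  refine HomologicalComplex.ExactAt.isZero_homology ?_
  rw [HomologicalComplex.exactAt_iff' _ (n + 2) (n + 1) n (by simp) (by simp),
    ShortComplex.ab_exact_iff]
  intro z hz
  obtain ⟨w, hw⟩ := h n z ((congrArg (fun f => (AddCommGrpCat.Hom.hom f) z)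
    (normalizedComplex_d A n)).symm.trans hz)
  exact ⟨w, (congrArg (fun f => (AddCommGrpCat.Hom.hom f) w)
    (normalizedComplex_d A (n + 1))).trans hw⟩

theorem normalizedApp_diff_apply (φ : A ⟶ B) (k : ℕ)
    (z : AddCommGrpCat.of (A.obj (op (cube (k + 1))) ⧸ degenerate A (k + 1))) :
    (normalizedDiff B k).hom ((normalizedApp φ (k + 1)).hom z) =
      (normalizedApp φ k).hom ((normalizedDiff A k).hom z) :=
  ConcreteCategory.congr_hom (normalizedApp_diff φ k) z

theorem IsAcyclic.of_retract (h : IsAcyclic A) (s : B ⟶ A) (r : A ⟶ B) (hsr : s ≫ r = 𝟙 B) :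
    IsAcyclic B := by
  intro n z hz
  obtain ⟨w, hw⟩ := h n ((normalizedApp s (n + 1)).hom z) (by
    rw [normalizedApp_diff_apply, hz, map_zero])
  refine ⟨(normalizedApp r (n + 2)).hom w, ?_⟩
  rw [normalizedApp_diff_apply, hw]
  obtain ⟨z, rfl⟩ := QuotientAddGroup.mk_surjective z
  exact congrArg (QuotientAddGroup.mk (s := degenerate B (n + 1)))
    (ConcreteCategory.congr_hom (NatTrans.congr_app hsr (op (cube (n + 1)))) z)

/-- A chain of a coproduct is the finite sum of its components. Asking for the formula over every
larger finite set makes the elements that satisfy it visibly closed under addition. -/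
theorem exists_sigma_expansion {I : Type} [DecidableEq I] (A : I → CubeCatᵒᵖ ⥤ AddCommGrpCat.{u})
    (c : CubeCatᵒᵖ)
    (z : (∐ A).obj c) : ∃ s : Finset I, ∀ t : Finset I, s ⊆ t →
      z = ∑ i ∈ t, ((Sigma.ι A i).app c).hom (((Sigma.π A i).app c).hom z) := by
  let P : AddSubgroup ((∐ A).obj c) :=
    { carrier := {z | ∃ s : Finset I, ∀ t : Finset I, s ⊆ t →
        z = ∑ i ∈ t, ((Sigma.ι A i).app c).hom (((Sigma.π A i).app c).hom z)}
      zero_mem' := ⟨∅, fun t _ => by simp⟩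
      add_mem' := by
        rintro x y ⟨s, hs⟩ ⟨s', hs'⟩
        refine ⟨s ∪ s', fun t ht => ?_⟩
        simp only [map_add, Finset.sum_add_distrib]
        rw [← hs t (Finset.union_subset_left ht), ← hs' t (Finset.union_subset_right ht)]
      neg_mem' := by
        rintro x ⟨s, hs⟩
        refine ⟨s, fun t ht => ?_⟩
        simp only [map_neg, Finset.sum_neg_distrib]
        rw [← hs t ht] }
  have hP (i : I) (y : (A i).obj c) : ((Sigma.ι A i).app c).hom y ∈ P := by
    refine ⟨{i}, fun t ht => ?_⟩
    rw [Finset.sum_eq_single i]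
    · have h := ConcreteCategory.congr_hom (NatTrans.congr_app (Sigma.ι_π_eq_id A i) c) y
      exact (congrArg ((Sigma.ι A i).app c).hom h).symm
    · intro j _ hj
      have h := ConcreteCategory.congr_hom (NatTrans.congr_app (Sigma.ι_π_of_ne A hj.symm) c) y
      exact (congrArg ((Sigma.ι A j).app c).hom h).trans (map_zero _)
    · intro hi
      exact absurd (ht (Finset.mem_singleton_self i)) hi
  -- The quotient map by `P` vanishes on every summand, and evaluation at `c` preserves the
  -- coproduct; hence it is zero and `P` is everything.
  have hq : AddCommGrpCat.ofHom (QuotientAddGroup.mk' P) = 0 := by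
    refine (isColimitOfPreserves ((evaluation _ _).obj c)
      (colimit.isColimit (Discrete.functor A))).hom_ext fun ⟨i⟩ => ?_
    ext y
    exact (QuotientAddGroup.eq_zero_iff _).2 (hP i y)
  exact (QuotientAddGroup.eq_zero_iff _).1 (ConcreteCategory.congr_hom hq z)

/-- The components of a cycle are cycles, and only finitely many are needed to recover it, so chosen
fillings of these can be summed. -/
theorem IsAcyclic.sigma {I : Type} [DecidableEq I] (A : I → CubeCatᵒᵖ ⥤ AddCommGrpCat.{u})
    (h : ∀ i, IsAcyclic (A i)) : IsAcyclic (∐ A) := by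
  intro n z hz
  have hsum : ∃ s : Finset I, z = ∑ i ∈ s, (normalizedApp (Sigma.ι A i) (n + 1)).hom
      ((normalizedApp (Sigma.π A i) (n + 1)).hom z) := by
    obtain ⟨z, rfl⟩ := QuotientAddGroup.mk_surjective z
    obtain ⟨s, hs⟩ := exists_sigma_expansion A _ z
    refine ⟨s, (congrArg (QuotientAddGroup.mk' (degenerate (∐ A) (n + 1)))
      (hs s (Finset.Subset.refl _))).trans (map_sum _ _ _)⟩
  obtain ⟨s, hs⟩ := hsum
  choose w hw using fun i => h i n ((normalizedApp (Sigma.π A i) (n + 1)).hom z) (by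
    rw [normalizedApp_diff_apply, hz, map_zero])
  refine ⟨∑ i ∈ s, (normalizedApp (Sigma.ι A i) (n + 2)).hom (w i), ?_⟩
  rw [map_sum]
  refine Eq.trans (Finset.sum_congr rfl fun i _ => ?_) hs.symm
  rw [normalizedApp_diff_apply, hw]

end Acyclic

/-! ### Free cubical groups and the contraction of the standard cube -/

section FreeCubical

variable (M : AddCommGrpCat.{u})

/-- The cubical group freely generated by `M` in dimension `m`: the chains of the standard cube with
coefficients in `M`. -/
noncomputable abbrev freeCubical (m : ℕ) : CubeCatᵒᵖ ⥤ AddCommGrpCat.{u} :=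
  (evaluationLeftAdjoint AddCommGrpCat.{u} (op (cube m))).obj M

/-- The inclusion of the summand of a singular cube of the standard cube. -/
noncomputable def freeι {n m : ℕ} (f : cube n ⟶ cube m) :
    M ⟶ (freeCubical M m).obj (op (cube n)) :=
  Sigma.ι (fun _ : op (cube m) ⟶ op (cube n) => M) f.op

variable {M}

theorem free_hom_ext {n m : ℕ} {B : AddCommGrpCat.{u}}
    {φ ψ : (freeCubical M m).obj (op (cube n)) ⟶ B}
    (h : ∀ f : cube n ⟶ cube m, freeι M f ≫ φ = freeι M f ≫ ψ) : φ = ψ :=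
  Sigma.hom_ext _ _ fun f => h f.unop

/-- Homomorphisms out of a free cubical group are determined by their values on the summands. -/
noncomputable def freeDesc {n m : ℕ} {B : AddCommGrpCat.{u}} (φ : (cube n ⟶ cube m) → (M ⟶ B)) :
    (freeCubical M m).obj (op (cube n)) ⟶ B :=
  Limits.Sigma.desc fun f => φ f.unop

theorem freeι_desc {n m : ℕ} {B : AddCommGrpCat.{u}} (φ : (cube n ⟶ cube m) → (M ⟶ B))
    (f : cube n ⟶ cube m) : freeι M f ≫ freeDesc φ = φ f :=
  Sigma.ι_desc _ _

theorem freeι_map {n n' m : ℕ} (f : cube n ⟶ cube m) (α : cube n' ⟶ cube n) :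
    freeι M f ≫ (freeCubical M m).map α.op = freeι M (α ≫ f) :=
  Sigma.ι_desc _ _

theorem freeι_map_assoc {n n' m : ℕ} (f : cube n ⟶ cube m) (α : cube n' ⟶ cube n)
    {B : AddCommGrpCat.{u}} (φ : (freeCubical M m).obj (op (cube n')) ⟶ B) :
    freeι M f ≫ (freeCubical M m).map α.op ≫ φ = freeι M (α ≫ f) ≫ φ := by
  rw [← Category.assoc, freeι_map]

variable (M) in
/-- The functoriality of the free cubical groups in the cube. -/
noncomputable def freeMap {m m' : ℕ} (g : cube m ⟶ cube m') :
    freeCubical M m ⟶ freeCubical M m' where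
  app c := freeDesc (n := c.unop.dim) fun f => freeι M (f ≫ g)
  naturality c d α := by
    refine free_hom_ext (n := c.unop.dim) fun f => ?_
    have h₁ := freeι_map_assoc (M := M) f α.unop (freeDesc fun f => freeι M (f ≫ g))
    have h₂ := freeι_map (M := M) (f ≫ g) α.unop
    refine h₁.trans ?_
    rw [freeι_desc, Category.assoc, ← h₂]
    exact (congrArg (· ≫ (freeCubical M m').map α) (freeι_desc (fun f => freeι M (f ≫ g)) f)).symm

theorem freeι_freeMap_app {n m m' : ℕ} (f : cube n ⟶ cube m) (g : cube m ⟶ cube m') :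
    freeι M f ≫ (freeMap M g).app (op (cube n)) = freeι M (f ≫ g) :=
  freeι_desc _ f

theorem freeι_faceDiff {n m : ℕ} (f : cube (n + 1) ⟶ cube m) (i : Fin (n + 1)) :
    freeι M f ≫ faceDiff (freeCubical M m) i =
      freeι M (face i false ≫ f) - freeι M (face i true ≫ f) := by
  rw [faceDiff, Preadditive.comp_sub, freeι_map, freeι_map]

theorem freeι_degenerate_normalizedMk {n m : ℕ} (f : cube n ⟶ cube m) (i : Fin (n + 1)) :
    freeι M (degen i ≫ f) ≫ normalizedMk (freeCubical M m) (n + 1) = 0 := by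
  rw [← freeι_map, Category.assoc, degen_normalizedMk, comp_zero]

/-- Every morphism from a cube of positive dimension to the point factors through a degeneracy, so
the normalized chains vanish in positive degrees. -/
theorem isAcyclic_freeCubical_zero : IsAcyclic (freeCubical M 0) := by
  intro n z _
  refine ⟨0, ?_⟩
  obtain ⟨z, rfl⟩ := QuotientAddGroup.mk_surjective z
  have h : normalizedMk (freeCubical M 0) (n + 1) = 0 := by
    refine free_hom_ext fun f => ?_
    have hf : f = degen (Fin.last n) ≫ face (Fin.last n) false ≫ f :=
      cube_hom_ext fun x => funext fun j => j.elim0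
    rw [hf, freeι_degenerate_normalizedMk, comp_zero]
  exact (map_zero _).trans (ConcreteCategory.congr_hom h z).symm

section Contraction

variable {m : ℕ}

/-- The last coordinate of the morphism of cubes is constantly one. -/
def LastTrue {n : ℕ} (f : cube n ⟶ cube (m + 1)) : Prop :=
  ∀ x, f.1 x (Fin.last m) = true

open Classical in
variable (M m) in
/-- The homotopy that contracts the standard cube along its last coordinate. -/
noncomputable def homotopy (n : ℕ) : (freeCubical M (m + 1)).obj (op (cube n)) ⟶
    (freeCubical M (m + 1)).obj (op (cube (n + 1))) :=
  freeDesc fun f => if LastTrue f then freeι M (cyl (f ≫ degen (Fin.last m))) else 0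

theorem freeι_homotopy_of_lastTrue {n : ℕ} {f : cube n ⟶ cube (m + 1)} (h : LastTrue f) :
    freeι M f ≫ homotopy M m n = freeι M (cyl (f ≫ degen (Fin.last m))) := by
  rw [homotopy, freeι_desc, if_pos h]

theorem freeι_homotopy_of_not {n : ℕ} {f : cube n ⟶ cube (m + 1)} (h : ¬ LastTrue f) :
    freeι M f ≫ homotopy M m n = 0 := by
  rw [homotopy, freeι_desc, if_neg h]

theorem LastTrue.comp {n n' : ℕ} {f : cube n ⟶ cube (m + 1)} (h : LastTrue f)
    (α : cube n' ⟶ cube n) : LastTrue (α ≫ f) :=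
  fun x => h (α.1 x)

/-- This makes the homotopy descend to normalized chains: it takes degenerate chains to degenerate
chains. -/
theorem degen_homotopy {n : ℕ} (i : Fin (n + 1)) :
    (freeCubical M (m + 1)).map (degen i).op ≫ homotopy M m (n + 1) =
      homotopy M m n ≫ (freeCubical M (m + 1)).map (degen i.castSucc).op := by
  refine free_hom_ext fun f => ?_
  rw [freeι_map_assoc, ← Category.assoc]
  by_cases h : LastTrue f
  · rw [freeι_homotopy_of_lastTrue h, freeι_homotopy_of_lastTrue (h.comp _), freeι_map,
      Category.assoc, cyl_comp, cyl_degen]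
  -- A degeneracy has a face as section, so `f` can be recovered from `degen i ≫ f`, and with it the
  -- condition on the last coordinate.
  · have h' : ¬ LastTrue (degen i ≫ f) := fun h' => h (by
      have := h'.comp (face i false)
      rwa [← Category.assoc, face_comp_degen_self, Category.id_comp] at this)
    rw [freeι_homotopy_of_not h, freeι_homotopy_of_not h', zero_comp]

variable (M m) in
theorem exists_normalizedHomotopy (n : ℕ) :
    ∃ h, normalizedMk (freeCubical M (m + 1)) n ≫ h =
      homotopy M m n ≫ normalizedMk (freeCubical M (m + 1)) (n + 1) := by
  have hle : degenerate (freeCubical M (m + 1)) n ≤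
      (homotopy M m n ≫ normalizedMk (freeCubical M (m + 1)) (n + 1)).hom.ker := by
    cases n with
    | zero => exact bot_le
    | succ n =>
      refine iSup_le fun j => ?_
      rintro _ ⟨y, rfl⟩
      have h : (freeCubical M (m + 1)).map (degen j).op ≫ homotopy M m (n + 1) ≫
          normalizedMk (freeCubical M (m + 1)) (n + 2) = 0 := by
        rw [← Category.assoc, degen_homotopy, Category.assoc, degen_normalizedMk, comp_zero]
      exact ConcreteCategory.congr_hom h y
  exact ⟨AddCommGrpCat.ofHom (QuotientAddGroup.lift _ _ hle), rfl⟩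

variable (M m) in
/-- The homotopy on normalized chains. -/
noncomputable def normalizedHomotopy (n : ℕ) :=
  (exists_normalizedHomotopy M m n).choose

theorem normalizedMk_homotopy (n : ℕ) :
    normalizedMk (freeCubical M (m + 1)) n ≫ normalizedHomotopy M m n =
      homotopy M m n ≫ normalizedMk (freeCubical M (m + 1)) (n + 1) :=
  (exists_normalizedHomotopy M m n).choose_spec

theorem freeι_diff {n k : ℕ} (f : cube (n + 1) ⟶ cube k) :
    freeι M f ≫ diff (freeCubical M k) n = ∑ i : Fin (n + 1), (-1 : ℤ) ^ ((i : ℕ) + 1) •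
      (freeι M (face i false ≫ f) - freeι M (face i true ≫ f)) := by
  simp only [diff, Preadditive.comp_sum, Preadditive.comp_zsmul, freeι_faceDiff]

/-- Write `f` as `f' × 1`. The homotopy gives the cylinder `f' × I`: its side faces are the homotopy
applied to the faces of `f`, and its two ends are `f' × 0`, the reset of `f`, and `f` itself. -/
theorem freeι_homotopy_diff_of_lastTrue {n : ℕ} {f : cube (n + 1) ⟶ cube (m + 1)}
    (h : LastTrue f) :
    freeι M f ≫ homotopy M m (n + 1) ≫ diff (freeCubical M (m + 1)) (n + 1) =
      freeι M f ≫ diff (freeCubical M (m + 1)) n ≫ homotopy M m n +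
        (-1 : ℤ) ^ n • (freeι M (f ≫ reset (Fin.last m)) - freeι M f) := by
  rw [← Category.assoc, freeι_homotopy_of_lastTrue h, freeι_diff, ← Category.assoc, freeι_diff,
    Fin.sum_univ_castSucc, Preadditive.sum_comp]
  congr 1
  · refine Finset.sum_congr rfl fun i _ => ?_
    rw [Preadditive.zsmul_comp, Preadditive.sub_comp, freeι_homotopy_of_lastTrue (h.comp _),
      freeι_homotopy_of_lastTrue (h.comp _), Category.assoc, Category.assoc,
      cyl_comp (face i false), cyl_comp (face i true), cyl_face, cyl_face]
    rfl
  -- The end faces carry the sign `(-1) ^ (n + 2)`, which is `(-1) ^ n`.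
  · rw [face_last_cyl, face_last_cyl, ← eq_comp_face_last h, Category.assoc, Fin.val_last]
    congr 1
    ring

/-- The homotopy vanishes on `f` and on its faces, and the reset leaves `f` unchanged, so every term
is zero. -/
theorem freeι_homotopy_diff_of_false {n : ℕ} {f : cube (n + 1) ⟶ cube (m + 1)}
    (h : ∀ x, f.1 x (Fin.last m) = false) :
    freeι M f ≫ homotopy M m (n + 1) ≫ diff (freeCubical M (m + 1)) (n + 1) =
      freeι M f ≫ diff (freeCubical M (m + 1)) n ≫ homotopy M m n +
        (-1 : ℤ) ^ n • (freeι M (f ≫ reset (Fin.last m)) - freeι M f) := by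
  have hf {k : ℕ} (α : cube k ⟶ cube (n + 1)) : ¬ LastTrue (α ≫ f) := fun h' => by
    have := h' (fun _ => false)
    rw [comp_apply, h] at this
    exact Bool.noConfusion this
  have hf' : ¬ LastTrue f := by simpa using hf (𝟙 _)
  have he : f ≫ reset (Fin.last m) = f :=
    (Category.assoc _ _ _).symm.trans (eq_comp_face_last h).symm
  rw [← Category.assoc, freeι_homotopy_of_not hf', ← Category.assoc, freeι_diff,
    Preadditive.sum_comp, he]
  simp [Preadditive.sub_comp, freeι_homotopy_of_not (hf _)]

/-- Among the faces of `g × I` only the end `g × 1` has last coordinate constantly one, and the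
homotopy takes it back to `g × I`. The sign `(-1) ^ (n + 1)` of the last pair of faces meets the
minus sign of the end at one. -/
theorem freeι_cyl_diff_homotopy {n : ℕ} (g : cube n ⟶ cube m) :
    freeι M (cyl g) ≫ diff (freeCubical M (m + 1)) n ≫ homotopy M m n =
      (-1 : ℤ) ^ n • freeι M (cyl g) := by
  -- A side face of a cylinder still has the interval variable as last coordinate, so it takes the
  -- value `false` at the zero vertex.
  have hi (i : Fin n) (τ : Bool) : ¬ LastTrue (face i.castSucc τ ≫ cyl g) := fun h => by
    have h₁ : (face i.castSucc τ).1 (fun _ => false) (Fin.last n) = true := by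
      have h' := h (fun _ => false)
      rwa [comp_apply, cyl_apply, Fin.snoc_last] at h'
    obtain ⟨j, hj⟩ := Fin.exists_succAbove_eq (Fin.castSucc_lt_last i).ne'
    rw [← hj] at h₁
    exact Bool.noConfusion ((Fin.insertNth_apply_succAbove (α := fun _ => Bool)
      i.castSucc τ (fun _ => false) j).symm.trans h₁)
  have hl : ¬ LastTrue (g ≫ face (Fin.last m) false) := fun h => by
    have := h (fun _ => false)
    rw [comp_apply, face_last_apply, Fin.snoc_last] at this
    exact Bool.noConfusion this
  have hl' : LastTrue (g ≫ face (Fin.last m) true) := fun x => by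
    rw [comp_apply, face_last_apply, Fin.snoc_last]
  rw [← Category.assoc, freeι_diff, Preadditive.sum_comp, Fin.sum_univ_castSucc,
    Finset.sum_eq_zero, zero_add]
  · rw [Preadditive.zsmul_comp, Preadditive.sub_comp, face_last_cyl, face_last_cyl,
      freeι_homotopy_of_not hl, freeι_homotopy_of_lastTrue hl', Category.assoc,
      face_comp_degen_self, Category.comp_id, Fin.val_last, zero_sub, pow_succ]
    simp
  · intro i _
    rw [Preadditive.zsmul_comp, Preadditive.sub_comp, freeι_homotopy_of_not (hi i _),
      freeι_homotopy_of_not (hi i _), sub_zero, smul_zero]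

/-- Up to sign, a chain homotopy between the identity and the map that resets the last coordinate.
The identity is checked on generators by the three cases for the last coordinate; normalization is
essential in the nonconstant ones. -/
theorem normalizedHomotopy_diff (n : ℕ) :
    normalizedHomotopy M m (n + 1) ≫ normalizedDiff (freeCubical M (m + 1)) (n + 1) =
      normalizedDiff (freeCubical M (m + 1)) n ≫ normalizedHomotopy M m n +
        (-1 : ℤ) ^ n • (normalizedApp (freeMap M (reset (Fin.last m))) (n + 1) - 𝟙 _) := by
  let q := normalizedMk (freeCubical M (m + 1)) (n + 1)
  have h₁ : q ≫ normalizedHomotopy M m (n + 1) ≫ normalizedDiff (freeCubical M (m + 1)) (n + 1) =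
      homotopy M m (n + 1) ≫ diff (freeCubical M (m + 1)) (n + 1) ≫ q := by
    rw [← Category.assoc, normalizedMk_homotopy, Category.assoc, normalizedMk_diff]
  have h₂ : q ≫ normalizedDiff (freeCubical M (m + 1)) n ≫ normalizedHomotopy M m n =
      diff (freeCubical M (m + 1)) n ≫ homotopy M m n ≫ q := by
    rw [← Category.assoc, normalizedMk_diff, Category.assoc, normalizedMk_homotopy]
  rw [← cancel_epi q]
  refine free_hom_ext fun f => ?_
  have h₃ : freeι M f ≫ q ≫ normalizedApp (freeMap M (reset (Fin.last m))) (n + 1) =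
      freeι M (f ≫ reset (Fin.last m)) ≫ q := by
    rw [normalizedMk_app, ← Category.assoc, freeι_freeMap_app]
  have key (h : freeι M f ≫ homotopy M m (n + 1) ≫ diff (freeCubical M (m + 1)) (n + 1) =
      freeι M f ≫ diff (freeCubical M (m + 1)) n ≫ homotopy M m n +
        (-1 : ℤ) ^ n • (freeι M (f ≫ reset (Fin.last m)) - freeι M f)) :
      freeι M f ≫ homotopy M m (n + 1) ≫ diff (freeCubical M (m + 1)) (n + 1) ≫ q =
        freeι M f ≫ diff (freeCubical M (m + 1)) n ≫ homotopy M m n ≫ q +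
          (-1 : ℤ) ^ n • (freeι M (f ≫ reset (Fin.last m)) ≫ q - freeι M f ≫ q) := by
    have := congrArg (· ≫ q) h
    simpa only [Preadditive.add_comp, Preadditive.sub_comp, Preadditive.zsmul_comp,
      Category.assoc] using this
  rw [Preadditive.comp_add, Preadditive.comp_zsmul, Preadditive.comp_sub, Category.comp_id, h₁, h₂,
    Preadditive.comp_add, Preadditive.comp_zsmul, Preadditive.comp_sub, h₃]
  rcases last_coordinate_cases f with ⟨τ, hτ⟩ | hf | ⟨g, rfl⟩
  · cases τ
    · exact key (freeι_homotopy_diff_of_false hτ)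
    · exact key (freeι_homotopy_diff_of_lastTrue hτ)
  -- Here `f` and its reset are both degenerate, so every term vanishes after normalization, the
  -- homotopy and the differential being defined there.
  · have hq : freeι M f ≫ q = 0 := by rw [hf, freeι_degenerate_normalizedMk]
    have hq' : freeι M (f ≫ reset (Fin.last m)) ≫ q = 0 := by
      rw [hf, Category.assoc, freeι_degenerate_normalizedMk]
    rw [← h₁, ← h₂, hq', hq, sub_zero, smul_zero, add_zero, ← Category.assoc, hq, zero_comp,
      ← Category.assoc, hq, zero_comp]
  -- The homotopy kills a cylinder and its reset is degenerate; the identity says that the homotopy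
  -- of its boundary cancels the remaining term.
  · have hq' : freeι M (cyl g ≫ reset (Fin.last m)) ≫ q = 0 := by
      rw [reset, ← Category.assoc, cyl_degen_last, Category.assoc, freeι_degenerate_normalizedMk]
    have hg : ¬ LastTrue (cyl g) := fun h => by
      have := h (fun _ => false)
      rw [cyl_apply, Fin.snoc_last] at this
      exact Bool.noConfusion this
    have h₄ : freeι M (cyl g) ≫ diff (freeCubical M (m + 1)) n ≫ homotopy M m n ≫ q =
        (-1 : ℤ) ^ n • freeι M (cyl g) ≫ q := by
      rw [← Preadditive.zsmul_comp, ← freeι_cyl_diff_homotopy, Category.assoc, Category.assoc]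
    rw [← Category.assoc, freeι_homotopy_of_not hg, h₄, zero_comp]
    rw [hq', zero_sub, smul_neg, add_neg_cancel]

end Contraction

theorem normalizedApp_freeMap_comp {m m' m'' : ℕ} (g : cube m ⟶ cube m') (g' : cube m' ⟶ cube m'')
    (k : ℕ) : normalizedApp (freeMap M (g ≫ g')) k =
      normalizedApp (freeMap M g) k ≫ normalizedApp (freeMap M g') k := by
  rw [← cancel_epi (normalizedMk (freeCubical M m) k), normalizedMk_app, ← Category.assoc,
    normalizedMk_app, Category.assoc, normalizedMk_app, ← Category.assoc]
  congr 1
  refine free_hom_ext fun f => ?_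
  rw [freeι_freeMap_app, ← Category.assoc (freeι M f), freeι_freeMap_app, freeι_freeMap_app,
    Category.assoc]

/-- Resetting the last coordinate factors through the cube of one dimension less. A cycle is
therefore homologous to the image of a cycle there, which bounds by induction. -/
theorem isAcyclic_freeCubical (m : ℕ) : IsAcyclic (freeCubical M m) := by
  induction m with
  | zero => exact isAcyclic_freeCubical_zero
  | succ m ih =>
    intro n z hz
    have h : (normalizedDiff (freeCubical M (m + 1)) (n + 1)).hom
        ((normalizedHomotopy M m (n + 1)).hom z) =
          (normalizedHomotopy M m n).hom ((normalizedDiff (freeCubical M (m + 1)) n).hom z) + (-1 : ℤ) ^ n •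
            ((normalizedApp (freeMap M (reset (Fin.last m))) (n + 1)).hom z - z) :=
      ConcreteCategory.congr_hom (normalizedHomotopy_diff n) z
    obtain ⟨w, hw⟩ := ih n ((normalizedApp (freeMap M (degen (Fin.last m))) (n + 1)).hom z) (by
      rw [normalizedApp_diff_apply, hz, map_zero])
    have he : (normalizedApp (freeMap M (reset (Fin.last m))) (n + 1)).hom z =
        (normalizedApp (freeMap M (face (Fin.last m) false)) (n + 1)).hom
          ((normalizedApp (freeMap M (degen (Fin.last m))) (n + 1)).hom z) :=
      ConcreteCategory.congr_hom (normalizedApp_freeMap_comp (degen (Fin.last m)) _ (n + 1)) z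
    rw [hz, map_zero, zero_add, he, ← hw, ← normalizedApp_diff_apply] at h
    -- On a cycle the homotopy `h` and the reset `r` satisfy `d h z = (-1) ^ n (r z - z)`, so `z = r
    -- z - (-1) ^ n d h z`, where `r z` is the boundary of the image of `w`.
    refine ⟨(normalizedApp (freeMap M (face (Fin.last m) false)) (n + 2)).hom w -
      (-1 : ℤ) ^ n • (normalizedHomotopy M m (n + 1)).hom z, ?_⟩
    rw [map_sub, map_zsmul, h, smul_smul, ← mul_pow, neg_one_mul, neg_neg, one_pow, one_smul,
      sub_sub_cancel]

end FreeCubical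

/-! ### Acyclicity on projectives, and the conclusion -/

/-- A cubical group is a quotient of a coproduct of free ones. -/
theorem exists_epi_from_free (Q : CubeCatᵒᵖ ⥤ AddCommGrpCat.{u}) :
    ∃ f : (∐ fun m : ℕ => freeCubical (Q.obj (op (cube m))) m) ⟶ Q, Epi f := by
  let t (m : ℕ) := ((evaluationAdjunctionRight AddCommGrpCat.{u} (op (cube m))).homEquiv _ Q).symm
    (𝟙 (Q.obj (op (cube m))))
  refine ⟨Sigma.desc t, ?_⟩
  -- Evaluated at `c`, the summand of the same dimension already maps onto `Q.obj c`: the unit of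
  -- the adjunction supplies a section.
  have (c : CubeCatᵒᵖ) : Epi ((Limits.Sigma.desc t).app c) := by
    have e : ((evaluationAdjunctionRight AddCommGrpCat.{u} c).homEquiv _ Q) (t c.unop.dim) =
      𝟙 (Q.obj c) := Equiv.apply_symm_apply _ _
    rw [Adjunction.homEquiv_unit] at e
    have e₂ : t c.unop.dim = Sigma.ι (fun m : ℕ => freeCubical (Q.obj (op (cube m))) m) c.unop.dim ≫
      Limits.Sigma.desc t := (Sigma.ι_desc _ _).symm
    rw [e₂, Functor.map_comp, ← Category.assoc] at e
    exact epi_of_epi_fac e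
  exact NatTrans.epi_of_epi_app _

/-- Projectivity splits the epimorphism from a coproduct of free cubical groups, and acyclicity
passes to coproducts and retracts. -/
theorem isAcyclic_of_projective (Q : CubeCatᵒᵖ ⥤ AddCommGrpCat.{u}) [Projective Q] :
    IsAcyclic Q := by
  obtain ⟨f, _⟩ := exists_epi_from_free Q
  exact (IsAcyclic.sigma _ fun m => isAcyclic_freeCubical m).of_retract
    (Projective.factorThru (𝟙 Q) f) f (Projective.factorThru_comp _ _)

/-- The colimit of a contravariant system is the colimit of its chains. -/
noncomputable def chainsColimIso (X : CubeCatᵒᵖ ⥤ Type u) :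
    chainsFunctor X ⋙ (colim : (CubeCatᵒᵖ ⥤ AddCommGrpCat.{u}) ⥤ AddCommGrpCat.{u}) ≅
      (colim : ((SingularCubes X)ᵒᵖ ⥤ AddCommGrpCat.{u}) ⥤ AddCommGrpCat.{u}) :=
  -- Both sides are left adjoint to the constant diagram functor, since a constant diagram
  -- restricted along the dimension functor is constant.
  ((chainsAdjunction X).comp colimConstAdj).leftAdjointUniq
    (colimConstAdj.ofNatIsoRight
      (NatIso.ofComponents fun _ => NatIso.ofComponents fun _ => Iso.refl _))

/-- The chain functor preserves projectives, because its right adjoint, restriction along the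
dimension functor, preserves epimorphisms. -/
theorem isZero_homology_chains_of_projective {X : CubeCatᵒᵖ ⥤ Type u}
    (P : (SingularCubes X)ᵒᵖ ⥤ AddCommGrpCat.{u}) [Projective P] (n : ℕ) :
    IsZero ((normalizedComplex (chains P)).homology (n + 1)) := by
  have : Projective ((chainsFunctor X).obj P) :=
    (chainsAdjunction X).map_projective P inferInstance
  exact (isAcyclic_of_projective ((chainsFunctor X).obj P)).isZero_homology n

end CubicalHomology

theorem theorem2 (X : CubicalHomology.CubeCatᵒᵖ ⥤ Type u)
    (F : (CubicalHomology.SingularCubes X)ᵒᵖ ⥤ AddCommGrpCat.{u}) (n : ℕ) :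
    Nonempty ((CubicalHomology.normalizedComplex (CubicalHomology.chains F)).homology n ≅
      ((colim : ((CubicalHomology.SingularCubes X)ᵒᵖ ⥤ AddCommGrpCat.{u}) ⥤
        AddCommGrpCat.{u}).leftDerived n).obj F) :=
  CubicalHomology.homology_iso_leftDerived
    (CubicalHomology.chainsFunctor X ⋙ CubicalHomology.normalizedFunctor)
    (fun S hS => CubicalHomology.normalizedFunctor_shortExact
      (S.map (CubicalHomology.chainsFunctor X)) (CubicalHomology.chains_shortExact hS))
    (fun P _ n => CubicalHomology.isZero_homology_chains_of_projective P n) colim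
    (Functor.isoWhiskerLeft (CubicalHomology.chainsFunctor X)
      CubicalHomology.normalizedHomologyZeroIso ≪≫ CubicalHomology.chainsColimIso X) F n
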